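/- For real $\alpha$ put $e(\alpha)=\exp(2i\pi\alpha)$, and let the letter $p$ denote primes. There exists an absolute constant $C>0$ such that the following holds. Let $N\ge 10^{6}$, $M\ge\sqrt{N}$ and $\ell\ge 2$ be real numbers, let $R$ be the number of primes $p$ with $M+1\le p\le M+N$, and let $(u_p)_{M+1\le p\le M+N}$ be complex numbers with $$\sum_{M+1\le p\le M+N}|u_p|^2\le R .$$ Then $$\biggl(\int_0^1\biggl|\sum_{M+1\le p\le M+N}u_p\,e(p\alpha)\biggr|^{\ell}d\alpha\biggr)^{1/\ell}\le C\sqrt{\frac{N/\log N}{1+R}}\,\biggl(\int_0^1\biggl|\sum_{M+1\le p\le M+N}e(p\alpha)\biggr|^{\ell}d\alpha\biggr)^{1/\ell}.$$ -/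

import Mathlib

/-- `e(α) = exp(2iπα)`. -/
noncomputable def expE (α : ℝ) : ℂ :=
  Complex.exp (2 * (Real.pi : ℂ) * Complex.I * (α : ℂ))

/-- The finite set of the primes `p` with `M + 1 ≤ p ≤ M + N`, for real `M` and `N`. -/
noncomputable def primesInInterval (M N : ℝ) : Finset ℕ :=
  (Finset.Icc ⌈M + 1⌉₊ ⌊M + N⌋₊).filter Nat.Prime

theorem mem_primesInInterval {M N : ℝ} {p : ℕ} :
    p ∈ primesInInterval M N ↔ p.Prime ∧ M + 1 ≤ (p : ℝ) ∧ (p : ℝ) ≤ M + N := by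
  unfold primesInInterval
  rw [Finset.mem_filter, Finset.mem_Icc, Nat.ceil_le]
  constructor
  · rintro ⟨⟨h1, h2⟩, hp⟩
    exact ⟨hp, h1, (Nat.le_floor_iff' hp.ne_zero).1 h2⟩
  · rintro ⟨hp, h1, h2⟩
    exact ⟨⟨h1, (Nat.le_floor_iff' hp.ne_zero).2 h2⟩, hp⟩

/-- The trigonometric polynomial `α ↦ ∑_{M+1 ≤ p ≤ M+N} u_p e(pα)` over primes. -/
noncomputable def primeTrigPoly (M N : ℝ) (u : ℕ → ℂ) (α : ℝ) : ℂ :=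
  ∑ p ∈ primesInInterval M N, u p * expE ((p : ℝ) * α)

/-- Such a polynomial is continuous, so that its `L^l` means are genuine integrals. -/
theorem continuous_primeTrigPoly (M N : ℝ) (u : ℕ → ℂ) :
    Continuous (primeTrigPoly M N u) := by
  unfold primeTrigPoly expE
  fun_prop

/-! Write S_u for the polynomial with coefficients u_p, S for the one with all coefficients 1, and l
= 2(1+η). The l-th moment of S_u is bounded above, that of S below, and the two bounds match up to a
constant that stays bounded after taking l-th roots.

The core is `sum_sq_trigPoly_primes_le`: at K well-spaced points, the sum of |S_u(x)|² is O((N/log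
N) log(4K) ∑|u_p|²), which for small K beats the usual large sieve. The primes in play exceed the
sieve level z, so they are prime to each squarefree q ≤ z; Ramanujan sums and Cauchy–Schwarz then
give |S_u(x)|² ≤ φ(q) ∑_a |S_u(x+a/q)|². Divide by φ(q), sum over q and x, and apply the large sieve
to the points x+a/q. These must not collide, so q is restricted to prime factors above w = 4K and to
non-multiples of certain primes attached to the pairs (x, y). By `sum_sieveModuli_dvd_le` this costs
at most half of ∑ 1/φ(q), and what is left is ≫ log N / log(4K) by `log_le_prod_mul_sum` and Mertens
(`prod_primes_le`).

Since this holds for every subset of a well-spaced set, the values |S_u|² are majorized by A·log 4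
and the increments A·log(1+1/k) ≤ A/k, where A is of order (N/log N)R. Hence (`sum_rpow_le_of_log`)
the moment is at most about A^(1+η) N⁻¹ ∑_{k≤N} k^(-1-η). Conversely, the same Ramanujan identity
shows that S is large on average near the fractions a/q, so its moment is ≫ N⁻¹ (R/2)^l ∑_{q≤z}
φ(q)^(1-l) over squarefree q (`le_integral_rpow_trigPoly_primes`). Both local sums have order
min(log N, 1/η) up to bounded terms, and `sum_rpow_le_sum_totient_rpow` bounds the first by the
second uniformly in η. The ratio A/R² then supplies the factor √((N/log N)/(1+R)). -/

/-! ### Additive characters and Parseval's identity. -/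

theorem expE_add (a b : ℝ) : expE (a + b) = expE a * expE b := by
  unfold expE
  rw [← Complex.exp_add]
  push_cast
  ring_nf

theorem norm_expE (a : ℝ) : ‖expE a‖ = 1 := by
  unfold expE
  rw [Complex.norm_exp]
  simp

theorem expE_eq (a : ℝ) : expE a = Complex.exp (((2 * Real.pi * a : ℝ) : ℂ) * Complex.I) := by
  unfold expE
  push_cast
  ring_nf

theorem expE_re (a : ℝ) : (expE a).re = Real.cos (2 * Real.pi * a) := by
  rw [expE_eq, Complex.exp_ofReal_mul_I_re]

theorem conj_expE (a : ℝ) : (starRingEnd ℂ) (expE a) = expE (-a) := by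
  unfold expE
  rw [← Complex.exp_conj]
  simp [Complex.conj_ofNat]

theorem expE_int (m : ℤ) : expE (m : ℝ) = 1 := by
  unfold expE
  rw [Complex.exp_eq_one_iff]
  exact ⟨m, by push_cast; ring⟩

theorem expE_zero : expE 0 = 1 := by
  have := expE_int 0
  simpa using this

theorem continuous_expE : Continuous expE := by
  unfold expE
  fun_prop

theorem integral_expE_int (k : ℤ) :
    ∫ α in (0 : ℝ)..1, expE ((k : ℝ) * α) = if k = 0 then 1 else 0 := by
  split_ifs with h
  · simp [h, expE_zero]
  · have hc : (2 * (Real.pi : ℂ) * Complex.I * k) ≠ 0 := by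
      have : (k : ℂ) ≠ 0 := by exact_mod_cast h
      simp [Real.pi_ne_zero, Complex.I_ne_zero, this]
    have h1 := integral_exp_mul_complex (a := 0) (b := 1) hc
    have h2 : ∀ α : ℝ, expE ((k : ℝ) * α)
        = Complex.exp (2 * (Real.pi : ℂ) * Complex.I * k * α) := by
      intro α
      unfold expE
      push_cast
      ring_nf
    simp only [h2]
    rw [h1]
    have h3 : Complex.exp (2 * (Real.pi : ℂ) * Complex.I * k * (1 : ℝ)) = 1 := by
      rw [Complex.exp_eq_one_iff]
      exact ⟨k, by push_cast; ring⟩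
    rw [h3]
    simp

/-- The trigonometric polynomial `α ↦ ∑_{n ∈ s} u_n e(nα)`. -/
noncomputable def trigPoly (s : Finset ℕ) (u : ℕ → ℂ) (α : ℝ) : ℂ :=
  ∑ n ∈ s, u n * expE ((n : ℝ) * α)

theorem continuous_trigPoly (s : Finset ℕ) (u : ℕ → ℂ) : Continuous (trigPoly s u) := by
  unfold trigPoly expE
  fun_prop

theorem trigPoly_add_int (s : Finset ℕ) (u : ℕ → ℂ) (α : ℝ) (m : ℤ) :
    trigPoly s u (α + m) = trigPoly s u α := by
  unfold trigPoly
  refine Finset.sum_congr rfl fun n _ => ?_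
  have : ((n : ℝ) * (m : ℝ)) = (((n : ℤ) * m : ℤ) : ℝ) := by push_cast; ring
  rw [mul_add, expE_add, this, expE_int, mul_one]

/-- Parseval's identity. -/
theorem integral_norm_sq_trigPoly (s : Finset ℕ) (u : ℕ → ℂ) :
    ∫ α in (0 : ℝ)..1, ‖trigPoly s u α‖ ^ 2 = ∑ n ∈ s, ‖u n‖ ^ 2 := by
  have key : ∫ α in (0 : ℝ)..1, ((‖trigPoly s u α‖ ^ 2 : ℝ) : ℂ) =
      ((∑ n ∈ s, ‖u n‖ ^ 2 : ℝ) : ℂ) := by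
    have h1 : ∀ α : ℝ, ((‖trigPoly s u α‖ ^ 2 : ℝ) : ℂ) =
        ∑ n ∈ s, ∑ m ∈ s, u n * (starRingEnd ℂ) (u m) * expE ((((n : ℤ) - m : ℤ) : ℝ) * α) := by
      intro α
      have : ((‖trigPoly s u α‖ ^ 2 : ℝ) : ℂ) =
          trigPoly s u α * (starRingEnd ℂ) (trigPoly s u α) := by
        rw [Complex.mul_conj']; push_cast; rfl
      rw [this]
      unfold trigPoly
      rw [map_sum, Finset.sum_mul_sum]
      refine Finset.sum_congr rfl fun n _ => Finset.sum_congr rfl fun m _ => ?_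
      rw [map_mul, conj_expE]
      have : ((((n : ℤ) - m : ℤ) : ℝ) * α) = (n : ℝ) * α + -((m : ℝ) * α) := by push_cast; ring
      rw [this, expE_add]
      ring
    have hcont : ∀ (c : ℂ) (k : ℤ), Continuous (fun α : ℝ => c * expE ((k : ℝ) * α)) :=
      fun c k => continuous_const.mul (continuous_expE.comp (by fun_prop))
    have hint : ∀ (c : ℂ) (k : ℤ), IntervalIntegrable (fun α : ℝ => c * expE ((k : ℝ) * α))
        MeasureTheory.volume 0 1 := by
      intro c k
      exact (hcont c k).intervalIntegrable _ _
    simp only [h1]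
    rw [intervalIntegral.integral_finsetSum]
    · rw [Complex.ofReal_sum]
      refine Finset.sum_congr rfl fun n hn => ?_
      rw [intervalIntegral.integral_finsetSum (fun m _ => hint _ _)]
      simp only [intervalIntegral.integral_const_mul, integral_expE_int, sub_eq_zero, Nat.cast_inj]
      simp only [mul_ite, mul_one, mul_zero, Finset.sum_ite_eq, hn, if_true]
      rw [Complex.mul_conj']
      push_cast
      rfl
    · intro n _
      exact (continuous_finsetSum _ fun m _ => hcont _ _).intervalIntegrable _ _
  rw [intervalIntegral.integral_ofReal] at key
  exact_mod_cast key

/-! ### The large sieve inequality. -/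

/-- Integrals over arcs starting at points that are `δ`-separated modulo `1`. -/
theorem sum_integral_arc_le {ι : Type*} (I : Finset ι) (x : ι → ℝ) {δ : ℝ} (h0 : 0 < δ)
    (h1 : δ ≤ 1) (g : ℝ → ℝ) (hc : Continuous g) (hg : ∀ t, 0 ≤ g t)
    (hp : ∀ (t : ℝ) (m : ℤ), g (t + m) = g t)
    (hsep : ∀ i ∈ I, ∀ j ∈ I, i ≠ j → ∀ m : ℤ, δ ≤ |x i - x j - m|) :
    ∑ i ∈ I, ∫ t in (0 : ℝ)..δ, g (x i + t) ≤ 2 * ∫ t in (0 : ℝ)..1, g t := by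
  have e1 : ∀ i, ∫ t in (0 : ℝ)..δ, g (x i + t)
      = ∫ t in Set.Ioc (Int.fract (x i)) (Int.fract (x i) + δ), g t := by
    intro i
    have : ∀ t, g (x i + t) = g (Int.fract (x i) + t) := by
      intro t
      rw [← hp (Int.fract (x i) + t) ⌊x i⌋]
      congr 1
      have := Int.fract_add_floor (x i)
      linarith
    simp only [this]
    rw [intervalIntegral.integral_comp_add_left (fun t => g t) (Int.fract (x i)), add_zero,
      intervalIntegral.integral_of_le (by linarith)]
  simp only [e1]
  rw [← MeasureTheory.integral_biUnion_finset]
  · have hper : Function.Periodic g 1 := fun t => by simpa using hp t 1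
    -- Arcs moved to start in [0, 1) have length at most 1, so they lie in two periods; separation
    -- makes them disjoint.
    have e2 : 2 * ∫ t in (0 : ℝ)..1, g t = ∫ t in Set.Ioc (0 : ℝ) 2, g t := by
      rw [← intervalIntegral.integral_of_le (by norm_num),
        ← intervalIntegral.integral_add_adjacent_intervals (a := 0) (b := 1) (c := 2)
          (hc.intervalIntegrable _ _) (hc.intervalIntegrable _ _)]
      have := hper.intervalIntegral_add_eq 0 1
      norm_num at this
      rw [← this]
      ring
    rw [e2]
    apply MeasureTheory.setIntegral_mono_set
    · exact (hc.integrableOn_Icc).mono_set Set.Ioc_subset_Icc_self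
    · exact Filter.Eventually.of_forall hg
    · apply Filter.Eventually.of_forall
      intro t ht
      obtain ⟨i, -, ht⟩ := Set.mem_iUnion₂.1 ht
      have := Int.fract_nonneg (x i)
      have := Int.fract_lt_one (x i)
      exact ⟨by linarith [ht.1], by linarith [ht.2]⟩
  · intro i _
    exact measurableSet_Ioc
  · intro i hi j hj hij
    rw [Function.onFun, Set.disjoint_left]
    intro t hti htj
    have h := hsep i hi j hj hij (⌊x i⌋ - ⌊x j⌋)
    have hfi := Int.fract_add_floor (x i)
    have hfj := Int.fract_add_floor (x j)
    have : x i - x j - ((⌊x i⌋ - ⌊x j⌋ : ℤ) : ℝ) = Int.fract (x i) - Int.fract (x j) := by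
      push_cast; linarith
    rw [this] at h
    have h2 : |Int.fract (x i) - Int.fract (x j)| < δ := by
      rw [abs_lt]
      constructor <;> linarith [hti.1, hti.2, htj.1, htj.2]
    linarith
  · intro i _
    exact (hc.integrableOn_Icc).mono_set Set.Ioc_subset_Icc_self

/-- Cauchy–Schwarz, obtained by expanding the integral of (δh - c)², where c is the integral of h.
-/
theorem sq_integral_le {δ : ℝ} (h0 : 0 < δ) (h : ℝ → ℝ) (hc : Continuous h) :
    (∫ t in (0 : ℝ)..δ, h t) ^ 2 ≤ δ * ∫ t in (0 : ℝ)..δ, h t ^ 2 := by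
  set c := (∫ t in (0 : ℝ)..δ, h t) with hcdef
  have h1 : 0 ≤ ∫ t in (0 : ℝ)..δ, (δ * h t - c) ^ 2 :=
    intervalIntegral.integral_nonneg h0.le fun t _ => sq_nonneg _
  have h2 : ∀ t, (δ * h t - c) ^ 2 = δ ^ 2 * h t ^ 2 - (2 * δ * c) * h t + c ^ 2 := by
    intro t; ring
  simp only [h2] at h1
  rw [intervalIntegral.integral_add, intervalIntegral.integral_sub,
    intervalIntegral.integral_const_mul, intervalIntegral.integral_const_mul, ← hcdef,
    intervalIntegral.integral_const] at h1
  · simp only [sub_zero, smul_eq_mul] at h1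
    have h3 : 0 ≤ δ * (δ * (∫ t in (0 : ℝ)..δ, h t ^ 2) - c ^ 2) := by nlinarith
    have := nonneg_of_mul_nonneg_right h3 h0
    linarith
  all_goals exact Continuous.intervalIntegrable (by fun_prop) _ _

/-- This is what fixes the arc length 1/(6N): the phases (n - M)t then stay within a sixth of a
turn. -/
theorem half_le_re_expE {a : ℝ} (h0 : 0 ≤ a) (h1 : a ≤ 1 / 6) : 1 / 2 ≤ (expE a).re := by
  rw [expE_re, ← Real.cos_pi_div_three]
  apply Real.cos_le_cos_of_nonneg_of_le_pi
  · positivity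
  · linarith [Real.pi_pos]
  · nlinarith [Real.pi_pos]

/-- The large sieve inequality at points that are `1 / (6 N)`-separated modulo `1`. -/
theorem large_sieve {ι : Type*} (I : Finset ι) (x : ι → ℝ) {M N : ℝ} (hN : 1 ≤ N)
    (s : Finset ℕ) (hs : ∀ n ∈ s, M ≤ n ∧ (n : ℝ) ≤ M + N) (u : ℕ → ℂ)
    (hsep : ∀ i ∈ I, ∀ j ∈ I, i ≠ j → ∀ m : ℤ, 1 / (6 * N) ≤ |x i - x j - m|) :
    ∑ i ∈ I, ‖trigPoly s u (x i)‖ ^ 2 ≤ 48 * N * ∑ n ∈ s, ‖u n‖ ^ 2 := by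
  set δ : ℝ := 1 / (6 * N) with hδ
  have h0 : 0 < δ := by positivity
  have h1 : δ ≤ 1 := by
    rw [hδ, div_le_one (by positivity)]
    linarith
  have hδN : N * δ = 1 / 6 := by
    rw [hδ]
    field_simp
  -- Dividing the coefficients by `J n` turns a point value into an integral, over an arc, of
  -- another polynomial whose coefficients are at most 2/δ times larger. The final constant is 2δ ·
  -- 4/δ² = 48N.
  set J : ℕ → ℂ := fun n => ∫ t in (0 : ℝ)..δ, expE (((n : ℝ) - M) * t) with hJ
  have hcont : ∀ n : ℕ, Continuous fun t : ℝ => expE (((n : ℝ) - M) * t) := fun n =>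
    continuous_expE.comp (by fun_prop)
  have hJn : ∀ n ∈ s, δ / 2 ≤ ‖J n‖ := by
    intro n hn
    obtain ⟨hn1, hn2⟩ := hs n hn
    refine le_trans ?_ (Complex.re_le_norm _)
    have e1 : (J n).re = ∫ t in (0 : ℝ)..δ, (expE (((n : ℝ) - M) * t)).re := by
      have := Complex.reCLM.intervalIntegral_comp_comm ((hcont n).intervalIntegrable 0 δ)
        (μ := MeasureTheory.volume)
      simpa using this.symm
    rw [e1]
    have e2 : ∫ t in (0 : ℝ)..δ, (1 / 2 : ℝ) = δ / 2 := by
      rw [intervalIntegral.integral_const]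
      simp
      ring
    rw [← e2]
    apply intervalIntegral.integral_mono_on h0.le
    · exact continuous_const.intervalIntegrable _ _
    · exact (Complex.continuous_re.comp (hcont n)).intervalIntegrable _ _
    · intro t ht
      apply half_le_re_expE
      · exact mul_nonneg (by linarith) ht.1
      · calc ((n : ℝ) - M) * t ≤ N * δ :=
              mul_le_mul (by linarith) ht.2 ht.1 (by linarith)
          _ = 1 / 6 := hδN
  set v : ℕ → ℂ := fun n => u n / J n with hv
  have hrep : ∀ y : ℝ, ‖trigPoly s u y‖ ≤ ∫ t in (0 : ℝ)..δ, ‖trigPoly s v (y + t)‖ := by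
    intro y
    have e1 : trigPoly s u y = ∫ t in (0 : ℝ)..δ, expE (-(M * t)) * trigPoly s v (y + t) := by
      have e2 : ∀ t : ℝ, expE (-(M * t)) * trigPoly s v (y + t) =
          ∑ n ∈ s, v n * expE (n * y) * expE (((n : ℝ) - M) * t) := by
        intro t
        unfold trigPoly
        rw [Finset.mul_sum]
        refine Finset.sum_congr rfl fun n _ => ?_
        have : ((n : ℝ) - M) * t = n * t + -(M * t) := by ring
        rw [this, expE_add, mul_add, expE_add]
        ring
      simp only [e2]
      rw [intervalIntegral.integral_finsetSum]
      · unfold trigPoly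
        refine Finset.sum_congr rfl fun n hn => ?_
        rw [intervalIntegral.integral_const_mul]
        have hne : J n ≠ 0 := by
          have := hJn n hn
          rw [← norm_pos_iff]
          linarith
        change _ = u n / J n * expE (n * y) * J n
        field_simp
      · intro n _
        exact (continuous_const.mul (hcont n)).intervalIntegrable _ _
    rw [e1]
    refine (intervalIntegral.norm_integral_le_integral_norm h0.le).trans (le_of_eq ?_)
    simp only [norm_mul, norm_expE, one_mul]
  have hcv : Continuous fun t => ‖trigPoly s v t‖ := (continuous_trigPoly s v).norm
  calc ∑ i ∈ I, ‖trigPoly s u (x i)‖ ^ 2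
      ≤ ∑ i ∈ I, δ * ∫ t in (0 : ℝ)..δ, ‖trigPoly s v (x i + t)‖ ^ 2 := by
        refine Finset.sum_le_sum fun i _ => ?_
        refine le_trans ?_ (sq_integral_le h0 _ (hcv.comp (continuous_const.add continuous_id)))
        exact pow_le_pow_left₀ (norm_nonneg _) (hrep _) 2
    _ = δ * ∑ i ∈ I, ∫ t in (0 : ℝ)..δ, ‖trigPoly s v (x i + t)‖ ^ 2 := by
        rw [Finset.mul_sum]
    _ ≤ δ * (2 * ∫ t in (0 : ℝ)..1, ‖trigPoly s v t‖ ^ 2) := by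
        refine mul_le_mul_of_nonneg_left ?_ h0.le
        refine sum_integral_arc_le I x h0 h1 (fun t => ‖trigPoly s v t‖ ^ 2) (hcv.pow 2)
          (fun t => by positivity) (fun t m => ?_) hsep
        simp only [trigPoly_add_int]
    _ = 2 * δ * ∑ n ∈ s, ‖v n‖ ^ 2 := by
        rw [integral_norm_sq_trigPoly]
        ring
    _ ≤ 2 * δ * ∑ n ∈ s, (4 / δ ^ 2) * ‖u n‖ ^ 2 := by
        refine mul_le_mul_of_nonneg_left (Finset.sum_le_sum fun n hn => ?_) (by positivity)
        have hn' := hJn n hn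
        have hpos : 0 < ‖J n‖ := by linarith
        rw [hv]
        simp only [norm_div, div_pow]
        rw [div_eq_inv_mul]
        refine mul_le_mul_of_nonneg_right ?_ (by positivity)
        rw [inv_le_comm₀ (by positivity) (by positivity)]
        calc (4 / δ ^ 2)⁻¹ = (δ / 2) ^ 2 := by field_simp; norm_num
          _ ≤ ‖J n‖ ^ 2 := pow_le_pow_left₀ (by positivity) hn' 2
    _ = 48 * N * ∑ n ∈ s, ‖u n‖ ^ 2 := by
        rw [← Finset.mul_sum, ← mul_assoc]
        congr 1
        rw [hδ]
        field_simp
        norm_num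

/-! ### Ramanujan sums and averaging over reduced fractions. -/

/-- Möbius inversion: summed over the divisors of n, these sums give the sum of all n-th roots of
unity, which vanishes unless n = 1. -/
theorem sum_primitiveRoots_complex {q : ℕ} (hq : 0 < q) :
    ∑ ζ ∈ primitiveRoots q ℂ, ζ = (ArithmeticFunction.moebius q : ℂ) := by
  have h : ∀ n > 0, ∑ i ∈ n.divisors, ∑ ζ ∈ primitiveRoots i ℂ, ζ
      = (fun n : ℕ => if n = 1 then (1 : ℂ) else 0) n := by
    intro n hn
    classical
    have hω := Complex.isPrimitiveRoot_exp n hn.ne'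
    rw [← Finset.sum_biUnion, ← IsPrimitiveRoot.nthRoots_one_eq_biUnion_primitiveRoots]
    · have e : ∑ ζ ∈ Polynomial.nthRootsFinset n (1 : ℂ), ζ
          = ∑ i ∈ Finset.range n, Complex.exp (2 * Real.pi * Complex.I / n) ^ i := by
        symm
        refine Finset.sum_bij (fun i _ => Complex.exp (2 * Real.pi * Complex.I / n) ^ i)
          ?_ ?_ ?_ ?_
        · intro i _
          rw [Polynomial.mem_nthRootsFinset hn, pow_right_comm, hω.pow_eq_one, one_pow]
        · intro i hi j hj hij
          exact hω.pow_inj (Finset.mem_range.1 hi) (Finset.mem_range.1 hj) hij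
        · intro b hb
          rw [Polynomial.mem_nthRootsFinset hn] at hb
          have : NeZero n := ⟨hn.ne'⟩
          obtain ⟨i, hi, h⟩ := hω.eq_pow_of_pow_eq_one hb
          exact ⟨i, Finset.mem_range.2 hi, h⟩
        · intro i _
          rfl
      rw [e]
      simp only
      split_ifs with h1
      · subst h1
        simp
      · exact hω.geom_sum_eq_zero (by omega)
    · intro i _ j _ hij
      exact IsPrimitiveRoot.disjoint hij
  have h2 := (ArithmeticFunction.sum_eq_iff_sum_mul_moebius_eq.1 h) q hq
  rw [← h2, Finset.sum_eq_single (q, 1)]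
  · simp
  · rintro ⟨a, b⟩ hab hne
    rw [Nat.mem_divisorsAntidiagonal] at hab
    have : b ≠ 1 := by
      rintro rfl
      apply hne
      simp only [mul_one] at hab
      rw [hab.1]
    simp [this]
  · intro hn
    exact absurd (Nat.mem_divisorsAntidiagonal.2 ⟨mul_one q, hq.ne'⟩) hn

/-- The numerators of the reduced fractions in `[0, 1)` with denominator `q`. -/
def numerators (q : ℕ) : Finset ℕ := (Finset.range q).filter q.Coprime

theorem card_numerators (q : ℕ) : (numerators q).card = q.totient := rfl

/-- The Ramanujan sum `c_q(n)` equals `μ(q)` for `n` prime to `q`. -/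
theorem sum_numerators_expE {q n : ℕ} (hq : 0 < q) (h : n.Coprime q) :
    ∑ a ∈ numerators q, expE ((n : ℝ) * ((a : ℝ) / q)) = (ArithmeticFunction.moebius q : ℂ) := by
  rw [← sum_primitiveRoots_complex hq]
  have hω := Complex.isPrimitiveRoot_exp_of_coprime n q hq.ne' h
  have : NeZero q := ⟨hq.ne'⟩
  have e : ∀ a : ℕ, expE ((n : ℝ) * ((a : ℝ) / q))
      = Complex.exp (2 * Real.pi * Complex.I * ((n : ℂ) / q)) ^ a := by
    intro a
    rw [← Complex.exp_nat_mul]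
    unfold expE
    push_cast
    ring_nf
  simp only [e]
  refine Finset.sum_bij (fun i _ => Complex.exp (2 * Real.pi * Complex.I * ((n : ℂ) / q)) ^ i)
    ?_ ?_ ?_ ?_
  · intro i hi
    rw [mem_primitiveRoots hq]
    exact hω.pow_of_coprime i (Finset.mem_filter.1 hi).2.symm
  · intro i hi j hj hij
    exact hω.pow_inj (Finset.mem_range.1 (Finset.mem_filter.1 hi).1)
      (Finset.mem_range.1 (Finset.mem_filter.1 hj).1) hij
  · intro b hb
    rw [mem_primitiveRoots hq, hω.isPrimitiveRoot_iff] at hb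
    obtain ⟨i, hi, hc, h⟩ := hb
    exact ⟨i, Finset.mem_filter.2 ⟨Finset.mem_range.2 hi, hc.symm⟩, h⟩
  · intro i _
    rfl

/-- Averaging over reduced fractions of denominator `q`, when the frequencies are prime to `q`. -/
theorem norm_trigPoly_le_sum {s : Finset ℕ} (u : ℕ → ℂ) {q : ℕ} (hq : Squarefree q)
    (hs : ∀ n ∈ s, n.Coprime q) (x : ℝ) :
    ‖trigPoly s u x‖ ≤ ∑ a ∈ numerators q, ‖trigPoly s u (x + (a : ℝ) / q)‖ := by
  have hq0 : 0 < q := Nat.pos_of_ne_zero hq.ne_zero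
  have e : ∑ a ∈ numerators q, trigPoly s u (x + (a : ℝ) / q)
      = (ArithmeticFunction.moebius q : ℂ) * trigPoly s u x := by
    unfold trigPoly
    rw [Finset.sum_comm, Finset.mul_sum]
    refine Finset.sum_congr rfl fun n hn => ?_
    rw [← sum_numerators_expE hq0 (hs n hn), Finset.sum_mul]
    refine Finset.sum_congr rfl fun a _ => ?_
    rw [mul_add, expE_add]
    ring
  have h1 : ‖(ArithmeticFunction.moebius q : ℂ)‖ = 1 := by
    have h2 : |ArithmeticFunction.moebius q| = 1 :=
      ArithmeticFunction.abs_moebius_eq_one_of_squarefree hq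
    rw [Complex.norm_intCast]
    exact_mod_cast h2
  calc ‖trigPoly s u x‖ = ‖∑ a ∈ numerators q, trigPoly s u (x + (a : ℝ) / q)‖ := by
        rw [e, norm_mul, h1, one_mul]
    _ ≤ _ := norm_sum_le _ _

/-! ### Mertens-type upper bounds. -/

/-- Sums of `k^{-1-σ}`. -/
theorem sum_rpow_le {σ : ℝ} (hσ : 0 < σ) (K : ℕ) :
    ∑ k ∈ Finset.Icc 1 K, (k : ℝ) ^ (-(1 + σ)) ≤ 1 + 1 / σ := by
  have h : ∀ K : ℕ, ∑ k ∈ Finset.Icc 1 (K + 1), (k : ℝ) ^ (-(1 + σ))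
      ≤ 1 + 1 / σ - 1 / σ * ((K + 1 : ℕ) : ℝ) ^ (-σ) := by
    intro K
    induction K with
    | zero => simp
    | succ K ih =>
      rw [Finset.sum_Icc_succ_top (by omega)]
      -- Telescoping form of the integral comparison: σ b^(-1-σ) ≤ (b-1)^(-σ) - b^(-σ), from (1 -
      -- 1/b)^(-σ) ≥ 1 + σ/b.
      have key : ((K + 1 + 1 : ℕ) : ℝ) ^ (-(1 + σ)) * σ + ((K + 1 + 1 : ℕ) : ℝ) ^ (-σ)
          ≤ ((K + 1 : ℕ) : ℝ) ^ (-σ) := by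
        set b : ℝ := ((K + 1 + 1 : ℕ) : ℝ) with hbdef
        have hb0 : 0 < b := by positivity
        have ha : ((K + 1 : ℕ) : ℝ) = b * (1 - 1 / b) := by
          rw [hbdef]
          push_cast
          field_simp
          ring
        have hb1 : 1 < b := by rw [hbdef]; push_cast; linarith [Nat.cast_nonneg (α := ℝ) K]
        have hlt : 1 / b < 1 := by rw [div_lt_one hb0]; exact hb1
        have hpos : 0 < 1 - 1 / b := by linarith
        rw [ha, Real.mul_rpow hb0.le hpos.le]
        have e1 : b ^ (-(1 + σ)) = b ^ (-σ) * (1 / b) := by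
          rw [show -(1 + σ) = -σ + (-1) by ring, Real.rpow_add hb0, Real.rpow_neg_one, one_div]
        rw [e1]
        have e2 : 1 + σ * (1 / b) ≤ (1 - 1 / b) ^ (-σ) := by
          rw [Real.rpow_def_of_pos hpos]
          have h1 : Real.log (1 - 1 / b) ≤ -(1 / b) := by
            have := Real.log_le_sub_one_of_pos hpos
            linarith
          have h2 := Real.add_one_le_exp (Real.log (1 - 1 / b) * -σ)
          nlinarith
        have := mul_le_mul_of_nonneg_left e2 (Real.rpow_nonneg hb0.le (-σ))
        linarith
      have : ((K + 1 + 1 : ℕ) : ℝ) ^ (-(1 + σ)) ≤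
          1 / σ * ((K + 1 : ℕ) : ℝ) ^ (-σ) - 1 / σ * ((K + 1 + 1 : ℕ) : ℝ) ^ (-σ) := by
        rw [← mul_sub, one_div, le_inv_mul_iff₀ hσ]
        linarith
      linarith
  rcases K with _ | K
  · simp
    positivity
  · refine (h K).trans ?_
    have : 0 ≤ 1 / σ * ((K + 1 : ℕ) : ℝ) ^ (-σ) := by positivity
    linarith

/-- The completely multiplicative function `n ↦ n^{-σ}`. -/
noncomputable def rpowNegHom (σ : ℝ) : ℕ →* ℝ where
  toFun n := (n : ℝ) ^ (-σ)
  map_one' := by simp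
  map_mul' m n := by
    rw [Nat.cast_mul, Real.mul_rpow (Nat.cast_nonneg _) (Nat.cast_nonneg _)]

theorem norm_rpowNegHom_lt_one {σ : ℝ} (hσ : 0 < σ) {p : ℕ} (hp : p.Prime) :
    ‖rpowNegHom σ p‖ < 1 := by
  change ‖(p : ℝ) ^ (-σ)‖ < 1
  rw [Real.norm_of_nonneg (by positivity)]
  exact Real.rpow_lt_one_of_one_lt_of_neg (by exact_mod_cast hp.one_lt) (by linarith)

/-- The Euler product over `s` is the full sum of 1/m over `s`-factored m, so it dominates every
finite part. -/
theorem sum_le_prod_of_factored (s T : Finset ℕ)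
    (hT : ∀ m ∈ T, m ∈ Nat.factoredNumbers s) :
    ∑ m ∈ T, (1 : ℝ) / m ≤ ∏ p ∈ s with p.Prime, (1 - 1 / (p : ℝ))⁻¹ := by
  have h := (EulerProduct.summable_and_hasSum_factoredNumbers_prod_filter_prime_geometric
    (f := rpowNegHom 1) (fun hp => norm_rpowNegHom_lt_one one_pos hp) s).2
  have e : ∀ m : ℕ, rpowNegHom 1 m = 1 / (m : ℝ) := by
    intro m
    change (m : ℝ) ^ (-1 : ℝ) = _
    rw [Real.rpow_neg_one, one_div]
  simp only [e] at h
  rw [show (fun m : Nat.factoredNumbers s => 1 / ((m : ℕ) : ℝ))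
    = (fun m : ℕ => 1 / (m : ℝ)) ∘ (↑) from rfl, hasSum_subtype_iff_indicator] at h
  calc ∑ m ∈ T, (1 : ℝ) / m
      = ∑ m ∈ T, (Nat.factoredNumbers s).indicator (fun m : ℕ => 1 / (m : ℝ)) m := by
        refine Finset.sum_congr rfl fun m hm => ?_
        rw [Set.indicator_of_mem (hT m hm)]
    _ ≤ _ := sum_le_hasSum T (fun m _ => Set.indicator_nonneg (fun m _ => by positivity) m) h

theorem prod_rpow_le {σ : ℝ} (hσ : 0 < σ) (s : Finset ℕ) :
    ∏ p ∈ s with p.Prime, (1 - (p : ℝ) ^ (-(1 + σ)))⁻¹ ≤ 1 + 1 / σ := by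
  have h := (EulerProduct.summable_and_hasSum_factoredNumbers_prod_filter_prime_geometric
    (f := rpowNegHom (1 + σ)) (fun hp => norm_rpowNegHom_lt_one (by linarith) hp) s).2
  refine hasSum_le_of_sum_le h fun t => ?_
  have e : ∑ i ∈ t, rpowNegHom (1 + σ) i
      = ∑ m ∈ t.map (Function.Embedding.subtype _), (m : ℝ) ^ (-(1 + σ)) := by
    rw [Finset.sum_map]
    rfl
  rw [e]
  refine le_trans ?_ (sum_rpow_le hσ ((t.map (Function.Embedding.subtype _)).sup id))
  refine Finset.sum_le_sum_of_subset_of_nonneg ?_ (fun _ _ _ => by positivity)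
  intro m hm
  rw [Finset.mem_Icc]
  refine ⟨?_, Finset.le_sup (f := id) hm⟩
  rw [Finset.mem_map] at hm
  obtain ⟨a, -, rfl⟩ := hm
  exact Nat.pos_of_ne_zero (Nat.ne_zero_of_mem_factoredNumbers a.2)

/-- An upper bound in Mertens' first theorem. -/
theorem sum_log_div_prime_le {n : ℕ} (hn : 1 ≤ n) :
    ∑ p ∈ Nat.primesLE n, Real.log p / p ≤ Real.log n + Real.log 4 := by
  have hprime : ∀ p ∈ Nat.primesLE n, p.Prime := fun p hp => (Nat.mem_primesLE.1 hp).2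
  -- Only the first term of Legendre's formula is kept; comparison with n! ≤ n^n follows, and
  -- replacing ⌊n/p⌋ by n/p costs θ(n) ≤ n log 4.
  have hdvd : ∏ p ∈ Nat.primesLE n, p ^ (n / p) ∣ n.factorial := by
    refine Finset.prod_dvd_of_isRelPrime ?_ ?_
    · intro p hp q hq hpq
      exact Nat.coprime_iff_isRelPrime.1
        (((Nat.coprime_primes (hprime p hp) (hprime q hq)).2 hpq).pow _ _)
    · intro p hp
      rw [(hprime p hp).pow_dvd_factorial_iff (Nat.lt_succ_of_lt (Nat.lt_succ_self _))]
      have := Finset.single_le_sum (f := fun i => n / p ^ i) (fun _ _ => Nat.zero_le _)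
        (Finset.mem_Ico.2 ⟨le_refl 1, by omega⟩ : 1 ∈ Finset.Ico 1 (Nat.log p n + 1).succ)
      simpa using this
  have hle := Nat.le_of_dvd n.factorial_pos hdvd
  have h1 : ∑ p ∈ Nat.primesLE n, ((n / p : ℕ) : ℝ) * Real.log p ≤ n * Real.log n := by
    have h2 : Real.log ((∏ p ∈ Nat.primesLE n, p ^ (n / p) : ℕ) : ℝ)
        ≤ Real.log (((n ^ n : ℕ)) : ℝ) := by
      apply Real.log_le_log
      · exact_mod_cast Finset.prod_pos fun p hp => pow_pos (hprime p hp).pos _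
      · exact_mod_cast hle.trans n.factorial_le_pow
    push_cast at h2
    rw [Real.log_prod, Real.log_pow] at h2
    · simpa only [Real.log_pow] using h2
    · intro p hp
      have := (hprime p hp).pos
      positivity
  have h3 : ∑ p ∈ Nat.primesLE n, Real.log p ≤ Real.log 4 * n := by
    rw [← Chebyshev.theta_eq_sum_primesLE_log]
    exact Chebyshev.theta_le_log4_mul_x (Nat.cast_nonneg n)
  have hn0 : (0 : ℝ) < n := by exact_mod_cast hn
  have h4 : n * ∑ p ∈ Nat.primesLE n, Real.log p / p ≤ n * (Real.log n + Real.log 4) := by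
    calc n * ∑ p ∈ Nat.primesLE n, Real.log p / p
        = ∑ p ∈ Nat.primesLE n, ((n : ℝ) / p) * Real.log p := by
          rw [Finset.mul_sum]
          exact Finset.sum_congr rfl fun p _ => by ring
      _ ≤ ∑ p ∈ Nat.primesLE n, (((n / p : ℕ) : ℝ) * Real.log p + Real.log p) := by
          refine Finset.sum_le_sum fun p hp => ?_
          have : (n : ℝ) / p ≤ ((n / p : ℕ) : ℝ) + 1 := by
            rw [← Nat.floor_div_eq_div (K := ℝ)]
            exact (Nat.lt_floor_add_one _).le
          have h0 : 0 ≤ Real.log p := Real.log_natCast_nonneg p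
          nlinarith
      _ ≤ _ := by
          rw [Finset.sum_add_distrib]
          linarith
  exact le_of_mul_le_mul_left h4 hn0

/-- An upper bound in Mertens' third theorem. -/
theorem prod_primes_le {y : ℕ} (hy : 2 ≤ y) :
    ∏ p ∈ Nat.primesLE y, (1 - 1 / (p : ℝ))⁻¹ ≤ 3 * Real.exp 6 * Real.log y := by
  have hy' : (2 : ℝ) ≤ y := by exact_mod_cast hy
  have hlog2 : Real.log 2 ≤ Real.log y := Real.log_le_log (by norm_num) hy'
  have hlog2' : 0.6931471803 < Real.log 2 := Real.log_two_gt_d9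
  have hlog : 0 < Real.log y := by linarith
  -- Rankin's choice: shifting the exponent from 1 to 1+σ costs exp(2σ ∑ log p / p) ≤ exp(2σ · 3 log
  -- y) = exp 6, while the shifted product is at most 1 + log y.
  set σ : ℝ := 1 / Real.log y with hσdef
  have hσ : 0 < σ := by positivity
  have hprime : ∀ p ∈ Nat.primesLE y, p.Prime := fun p hp => (Nat.mem_primesLE.1 hp).2
  have hstep : ∀ p ∈ Nat.primesLE y, (1 - 1 / (p : ℝ))⁻¹ ≤
      Real.exp (2 * σ * (Real.log p / p)) * (1 - (p : ℝ) ^ (-(1 + σ)))⁻¹ := by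
    intro p hp
    have hp2 : (2 : ℝ) ≤ p := by exact_mod_cast (hprime p hp).two_le
    have hp0 : (0 : ℝ) < p := by linarith
    have hhalf : 1 / (p : ℝ) ≤ 1 / 2 := one_div_le_one_div_of_le (by norm_num) hp2
    have e1 : (p : ℝ) ^ (-(1 + σ)) = 1 / p * (p : ℝ) ^ (-σ) := by
      rw [show -(1 + σ) = -1 + -σ by ring, Real.rpow_add hp0, Real.rpow_neg_one, one_div]
    have e2 : 1 - σ * Real.log p ≤ (p : ℝ) ^ (-σ) := by
      rw [Real.rpow_def_of_pos hp0]
      have := Real.add_one_le_exp (Real.log p * -σ)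
      linarith
    have e3 : (p : ℝ) ^ (-σ) ≤ 1 :=
      Real.rpow_le_one_of_one_le_of_nonpos (by linarith) (by linarith)
    have hinv : 0 < 1 / (p : ℝ) := by positivity
    have hd : 0 < 1 - (p : ℝ) ^ (-(1 + σ)) := by
      rw [e1]
      nlinarith
    have hd2 : 0 < 1 - 1 / (p : ℝ) := by linarith
    rw [← div_eq_mul_inv, le_div_iff₀ hd, ← div_eq_inv_mul, div_le_iff₀ hd2]
    have e4 := Real.add_one_le_exp (2 * σ * (Real.log p / p))
    have hlp : 0 ≤ Real.log p := Real.log_natCast_nonneg p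
    have e5 : 0 ≤ 2 * σ * (Real.log p / p) := by positivity
    calc 1 - (p : ℝ) ^ (-(1 + σ)) ≤ 1 - 1 / p * (1 - σ * Real.log p) := by
          rw [e1]
          have := mul_le_mul_of_nonneg_left e2 hinv.le
          linarith
      _ = (1 - 1 / p) + (2 * σ * (Real.log p / p)) * (1 / 2) := by ring
      _ ≤ (1 - 1 / p) + (2 * σ * (Real.log p / p)) * (1 - 1 / p) := by
          have := mul_le_mul_of_nonneg_left (by linarith : (1 : ℝ) / 2 ≤ 1 - 1 / p) e5
          linarith
      _ = (2 * σ * (Real.log p / p) + 1) * (1 - 1 / p) := by ring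
      _ ≤ _ := mul_le_mul_of_nonneg_right e4 hd2.le
  calc ∏ p ∈ Nat.primesLE y, (1 - 1 / (p : ℝ))⁻¹
      ≤ ∏ p ∈ Nat.primesLE y,
          (Real.exp (2 * σ * (Real.log p / p)) * (1 - (p : ℝ) ^ (-(1 + σ)))⁻¹) := by
        refine Finset.prod_le_prod (fun p hp => ?_) hstep
        have hp2 : (1 : ℝ) ≤ p := by exact_mod_cast (hprime p hp).one_lt.le
        have : 1 / (p : ℝ) ≤ 1 := by rw [div_le_one (by linarith)]; exact hp2
        rw [inv_nonneg]
        linarith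
    _ = Real.exp (2 * σ * ∑ p ∈ Nat.primesLE y, Real.log p / p) *
          ∏ p ∈ Nat.primesLE y, (1 - (p : ℝ) ^ (-(1 + σ)))⁻¹ := by
        rw [Finset.prod_mul_distrib, ← Real.exp_sum, Finset.mul_sum]
    _ ≤ Real.exp 6 * (3 * Real.log y) := by
        have hprod := prod_rpow_le hσ (Nat.primesLE y)
        rw [Finset.filter_true_of_mem hprime] at hprod
        refine mul_le_mul ?_ (hprod.trans ?_) ?_ (Real.exp_pos _).le
        · apply Real.exp_le_exp.2
          have h1 := sum_log_div_prime_le (n := y) (by omega)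
          have h4 : Real.log 4 = 2 * Real.log 2 := by
            rw [show (4 : ℝ) = 2 ^ 2 by norm_num, Real.log_pow]
            norm_num
          calc 2 * σ * ∑ p ∈ Nat.primesLE y, Real.log p / p
              ≤ 2 * σ * (3 * Real.log y) := by
                refine mul_le_mul_of_nonneg_left ?_ (by positivity)
                linarith
            _ = 6 := by
                rw [hσdef]
                field_simp
                norm_num
        · rw [hσdef, one_div_one_div]
          linarith
        · refine Finset.prod_nonneg fun p hp => ?_
          rw [inv_nonneg, sub_nonneg]
          refine Real.rpow_le_one_of_one_le_of_nonpos ?_ (by linarith)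
          exact_mod_cast (hprime p hp).one_lt.le
    _ = 3 * Real.exp 6 * Real.log y := by ring

/-! ### The sieve sum over rough squarefree moduli. -/

/-- The squarefree `q ≤ z` all of whose prime factors exceed `w`. -/
def sieveModuli (w z : ℕ) : Finset ℕ :=
  (Finset.Icc 1 z).filter fun q => Squarefree q ∧ ∀ p ∈ q.primeFactors, w < p

theorem mem_sieveModuli {w z q : ℕ} : q ∈ sieveModuli w z ↔
    (1 ≤ q ∧ q ≤ z) ∧ Squarefree q ∧ ∀ p ∈ q.primeFactors, w < p := by
  rw [sieveModuli, Finset.mem_filter, Finset.mem_Icc]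

theorem inv_totient_eq (q : ℕ) :
    (1 : ℝ) / q * ∏ p ∈ q.primeFactors, (1 - 1 / (p : ℝ))⁻¹ = 1 / (q.totient : ℝ) := by
  have h := Nat.totient_eq_mul_prod_factors q
  have h' : (q.totient : ℝ) = q * ∏ p ∈ q.primeFactors, (1 - (p : ℝ)⁻¹) := by
    simpa using congrArg (Rat.cast : ℚ → ℝ) h
  rw [h', Finset.prod_inv_distrib]
  simp only [one_div, mul_inv]

/-- The part of `n` made of its prime factors above `w`. -/
def roughRad (w n : ℕ) : ℕ := ∏ p ∈ n.primeFactors with w < p, p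

theorem primeFactors_roughRad (w n : ℕ) :
    (roughRad w n).primeFactors = n.primeFactors.filter (w < ·) := by
  unfold roughRad
  apply Nat.primeFactors_prod
  intro p hp
  exact Nat.prime_of_mem_primeFactors (Finset.mem_filter.1 hp).1

theorem roughRad_dvd (w n : ℕ) : roughRad w n ∣ n :=
  (Finset.prod_dvd_prod_of_subset _ _ _ (Finset.filter_subset _ _)).trans
    (Nat.prod_primeFactors_dvd n)

theorem squarefree_roughRad (w n : ℕ) : Squarefree (roughRad w n) := by
  refine Finset.squarefree_prod_of_pairwise_isCoprime (fun p hp q hq hpq => ?_) fun p hp => ?_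
  · exact Nat.coprime_iff_isRelPrime.1 ((Nat.coprime_primes
      (Nat.prime_of_mem_primeFactors (Finset.mem_filter.1 hp).1)
      (Nat.prime_of_mem_primeFactors (Finset.mem_filter.1 hq).1)).2 hpq)
  · exact (Nat.prime_of_mem_primeFactors (Finset.mem_filter.1 hp).1).squarefree

/-- A lower bound for the sieve sum. -/
theorem log_le_prod_mul_sum (w : ℕ) {z : ℕ} {y : ℝ} (hy : 0 < y) (hyz : y < z + 1) :
    Real.log y ≤ (∏ p ∈ Nat.primesLE w, (1 - 1 / (p : ℝ))⁻¹) *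
      ∑ q ∈ sieveModuli w z, 1 / (q.totient : ℝ) := by
  have hprime : ∀ p ∈ Nat.primesLE w, p.Prime := fun p hp => (Nat.mem_primesLE.1 hp).2
  have h1 : Real.log y ≤ ∑ n ∈ Finset.Icc 1 z, (1 : ℝ) / n := by
    have := log_add_one_le_harmonic z
    rw [harmonic_eq_sum_Icc] at this
    push_cast at this
    simp only [one_div]
    exact (Real.log_le_log hy hyz.le).trans this
  refine h1.trans ?_
  have hmaps : ∀ n ∈ Finset.Icc 1 z, roughRad w n ∈ sieveModuli w z := by
    intro n hn
    rw [Finset.mem_Icc] at hn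
    rw [mem_sieveModuli]
    refine ⟨⟨Nat.pos_of_dvd_of_pos (roughRad_dvd w n) hn.1,
      (Nat.le_of_dvd hn.1 (roughRad_dvd w n)).trans hn.2⟩, squarefree_roughRad w n, ?_⟩
    intro p hp
    rw [primeFactors_roughRad] at hp
    exact (Finset.mem_filter.1 hp).2
  -- Sort n ≤ z by q = `roughRad w n`. In n = q·m, every prime factor of m is at most w or divides
  -- q, so the fibre contributes at most 1/q times an Euler product, that is, 1/φ(q) times the
  -- product over p ≤ w.
  rw [← Finset.sum_fiberwise_of_maps_to hmaps, Finset.mul_sum]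
  refine Finset.sum_le_sum fun q hq => ?_
  obtain ⟨⟨hq1, -⟩, -, hqw⟩ := mem_sieveModuli.1 hq
  set F := (Finset.Icc 1 z).filter fun n => roughRad w n = q with hF
  have hFq : ∀ n ∈ F, 1 ≤ n ∧ roughRad w n = q ∧ q * (n / q) = n := by
    intro n hn
    rw [hF, Finset.mem_filter, Finset.mem_Icc] at hn
    refine ⟨hn.1.1, hn.2, Nat.mul_div_cancel' ?_⟩
    rw [← hn.2]
    exact roughRad_dvd w n
  have hinj : Set.InjOn (fun n => n / q) (F : Set ℕ) := by
    intro a ha b hb hab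
    rw [← (hFq a ha).2.2, ← (hFq b hb).2.2]
    simp only at hab
    rw [hab]
  have hfact := sum_le_prod_of_factored (Nat.primesLE w ∪ q.primeFactors)
    (F.image fun n => n / q) (by
      intro m hm
      obtain ⟨n, hn, rfl⟩ := Finset.mem_image.1 hm
      obtain ⟨hn1, hn2, hn3⟩ := hFq n hn
      apply Nat.mem_factoredNumbers_of_primeFactors_subset
      · intro h0
        rw [h0] at hn3
        omega
      · intro p hp
        have hpn : p ∈ n.primeFactors := Nat.primeFactors_mono ⟨q, by rw [mul_comm]; exact hn3.symm⟩
          (by omega) hp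
        rw [Finset.mem_union, Nat.mem_primesLE]
        rcases le_or_gt p w with h | h
        · exact Or.inl ⟨h, Nat.prime_of_mem_primeFactors hp⟩
        · right
          rw [← hn2, primeFactors_roughRad]
          exact Finset.mem_filter.2 ⟨hpn, h⟩)
  rw [Finset.sum_image hinj, Finset.filter_true_of_mem (by
    intro p hp
    rcases Finset.mem_union.1 hp with h | h
    · exact hprime p h
    · exact Nat.prime_of_mem_primeFactors h), Finset.prod_union (by
    rw [Finset.disjoint_left]
    intro p hp hp'
    have := hqw p hp'
    have := (Nat.mem_primesLE.1 hp).1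
    omega)] at hfact
  calc ∑ n ∈ F, (1 : ℝ) / n = 1 / q * ∑ n ∈ F, (1 : ℝ) / ((n / q : ℕ) : ℝ) := by
        rw [Finset.mul_sum]
        refine Finset.sum_congr rfl fun n hn => ?_
        obtain ⟨-, -, hn3⟩ := hFq n hn
        rw [← hn3]
        push_cast
        rw [hn3, ← one_div_mul_one_div]
    _ ≤ 1 / q * ((∏ p ∈ Nat.primesLE w, (1 - 1 / (p : ℝ))⁻¹) *
          ∏ p ∈ q.primeFactors, (1 - 1 / (p : ℝ))⁻¹) :=
        mul_le_mul_of_nonneg_left hfact (by positivity)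
    _ = _ := by
        rw [← inv_totient_eq q]
        ring

/-- The part of the sieve sum carried by the multiples of a prime is small. -/
theorem sum_sieveModuli_dvd_le (w z : ℕ) {p : ℕ} (hp : p.Prime) (hw : w < p) :
    (w : ℝ) * ∑ q ∈ sieveModuli w z with p ∣ q, 1 / (q.totient : ℝ) ≤
      ∑ q ∈ sieveModuli w z, 1 / (q.totient : ℝ) := by
  -- Division by p injects the multiples of p back into the moduli, and φ(q) = (p-1)φ(q/p) with p -
  -- 1 ≥ w.
  have hmem : ∀ q ∈ (sieveModuli w z).filter (p ∣ ·),
      q / p ∈ sieveModuli w z ∧ p * (q / p) = q ∧ q.totient = (p - 1) * (q / p).totient := by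
    intro q hq
    rw [Finset.mem_filter, mem_sieveModuli] at hq
    obtain ⟨⟨⟨h1, h2⟩, h3, h4⟩, h5⟩ := hq
    have e := Nat.mul_div_cancel' h5
    have hsq : Squarefree (q / p) := h3.squarefree_of_dvd ⟨p, by rw [mul_comm]; exact e.symm⟩
    refine ⟨mem_sieveModuli.2 ⟨⟨?_, (Nat.div_le_self _ _).trans h2⟩, hsq, ?_⟩, e, ?_⟩
    · exact Nat.pos_of_ne_zero hsq.ne_zero
    · intro r hr
      exact h4 r (Nat.primeFactors_mono ⟨p, by rw [mul_comm]; exact e.symm⟩ (by omega) hr)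
    · have hc : p.Coprime (q / p) := by
        rw [← e] at h3
        exact Nat.coprime_of_squarefree_mul h3
      conv_lhs => rw [← e]
      rw [Nat.totient_mul hc, Nat.totient_prime hp]
  have hinj : Set.InjOn (fun q => q / p) ((sieveModuli w z).filter (p ∣ ·) : Set ℕ) := by
    intro a ha b hb hab
    rw [← (hmem a ha).2.1, ← (hmem b hb).2.1]
    simp only at hab
    rw [hab]
  calc (w : ℝ) * ∑ q ∈ sieveModuli w z with p ∣ q, 1 / (q.totient : ℝ)
      ≤ ∑ q ∈ sieveModuli w z with p ∣ q, 1 / ((q / p).totient : ℝ) := by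
        rw [Finset.mul_sum]
        refine Finset.sum_le_sum fun q hq => ?_
        rw [(hmem q hq).2.2]
        push_cast [hp.one_lt.le]
        have h0 : (0 : ℝ) < (p : ℝ) - 1 := by
          have : (1 : ℝ) < p := by exact_mod_cast hp.one_lt
          linarith
        have hw' : (w : ℝ) ≤ (p : ℝ) - 1 := by
          have : (w : ℝ) + 1 ≤ p := by exact_mod_cast hw
          linarith
        rw [← one_div_mul_one_div, ← mul_assoc]
        refine mul_le_of_le_one_left (by positivity) ?_
        rw [mul_one_div, div_le_one h0]
        exact hw'
    _ = ∑ q ∈ ((sieveModuli w z).filter (p ∣ ·)).image (fun q => q / p),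
          1 / (q.totient : ℝ) := by
        rw [Finset.sum_image hinj]
    _ ≤ _ := by
        refine Finset.sum_le_sum_of_subset_of_nonneg ?_ (fun _ _ _ => by positivity)
        intro q hq
        obtain ⟨r, hr, rfl⟩ := Finset.mem_image.1 hq
        exact (hmem r hr).1

/-! ### Spacing of rationals and collisions between translates. -/

theorem one_div_den_le_abs {r : ℚ} (hr : r ≠ 0) : 1 / (r.den : ℝ) ≤ |(r : ℝ)| := by
  have hd : (0 : ℝ) < r.den := by exact_mod_cast r.den_pos
  have hn : (1 : ℝ) ≤ |(r.num : ℝ)| := by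
    have : 1 ≤ |r.num| := Int.one_le_abs (Rat.num_ne_zero.2 hr)
    exact_mod_cast this
  rw [Rat.cast_def, abs_div, abs_of_pos hd]
  exact div_le_div_of_nonneg_right hn hd.le

/-- Rational numbers of denominator at most `z ^ 2` are separated. -/
theorem rat_eq_of_abs_sub_lt {z : ℕ} {ε : ℝ} (hε : ε * z ^ 4 ≤ 1) {r t : ℚ} (hr : r.den ≤ z ^ 2)
    (ht : t.den ≤ z ^ 2) (h : |(r : ℝ) - t| < ε) : r = t := by
  by_contra hne
  have h1 := one_div_den_le_abs (sub_ne_zero.2 hne)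
  have h2 : (r - t).den ≤ z ^ 4 := by
    calc (r - t).den ≤ r.den * t.den :=
          Nat.le_of_dvd (Nat.mul_pos r.den_pos t.den_pos) (Rat.sub_den_dvd r t)
      _ ≤ z ^ 2 * z ^ 2 := Nat.mul_le_mul hr ht
      _ = z ^ 4 := by ring
  have h3 : ((r - t).den : ℝ) ≤ (z : ℝ) ^ 4 := by exact_mod_cast h2
  have hd : (0 : ℝ) < (r - t).den := by exact_mod_cast (r - t).den_pos
  rw [Rat.cast_sub] at h1
  have h4 : 1 / ((r - t).den : ℝ) < ε := lt_of_le_of_lt h1 h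
  rw [div_lt_iff₀ hd] at h4
  have h5 : 0 < ε := lt_of_le_of_lt (abs_nonneg _) h
  nlinarith

/-- Both fractions lie in [0, 1), so an integral difference is 0, and a reduced fraction determines
its numerator and denominator. -/
theorem numerators_div_eq_of_isInt {q q' a b : ℕ} (ha : a ∈ numerators q) (hb : b ∈ numerators q')
    {m : ℤ} (h : ((a : ℚ) / q - (b : ℚ) / q' - m).den = 1) : q = q' ∧ a = b := by
  rw [numerators, Finset.mem_filter, Finset.mem_range] at ha hb
  have hq : (0 : ℚ) < q := by exact_mod_cast (by omega : 0 < q)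
  have hq' : (0 : ℚ) < q' := by exact_mod_cast (by omega : 0 < q')
  have haq : (a : ℚ) / q < 1 := by rw [div_lt_one hq]; exact_mod_cast ha.1
  have hbq : (b : ℚ) / q' < 1 := by rw [div_lt_one hq']; exact_mod_cast hb.1
  have haq0 : 0 ≤ (a : ℚ) / q := by positivity
  have hbq0 : 0 ≤ (b : ℚ) / q' := by positivity
  obtain ⟨k, hk⟩ : ∃ k : ℤ, (a : ℚ) / q - (b : ℚ) / q' - m = k :=
    ⟨_, ((Rat.den_eq_one_iff _).1 h).symm⟩
  have hk' : (a : ℚ) / q - (b : ℚ) / q' = ((k + m : ℤ) : ℚ) := by push_cast; linarith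
  have h1 : ((k + m : ℤ) : ℚ) < 1 := by rw [← hk']; linarith
  have h2 : (-1 : ℚ) < ((k + m : ℤ) : ℚ) := by rw [← hk']; linarith
  have h1' : k + m < 1 := by exact_mod_cast h1
  have h2' : -1 < k + m := by exact_mod_cast h2
  have h0 : k + m = 0 := by omega
  rw [h0, Int.cast_zero, sub_eq_zero] at hk'
  have hden : ∀ c d : ℕ, 0 < d → d.Coprime c → ((c : ℚ) / d).den = d := by
    intro c d hd hcd
    have := Rat.den_div_eq_of_coprime (a := c) (b := d) (by exact_mod_cast hd)
      (by simpa using hcd.symm)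
    rw [Int.cast_natCast, Int.cast_natCast] at this
    exact Int.natCast_inj.1 this
  have e : q = q' := by
    rw [← hden a q (by omega) ha.2, hk', hden b q' (by omega) hb.2]
  refine ⟨e, ?_⟩
  subst e
  rw [div_left_inj' hq.ne'] at hk'
  exact_mod_cast hk'

/-- A prime that divides the denominators of all the rough rationals near `y - x`. -/
theorem exists_prime_dvd_den {z : ℕ} {δ : ℝ} (hδ : 2 * δ * z ^ 4 ≤ 1) (w : ℕ) (x y : ℝ) :
    ∃ p : ℕ, p.Prime ∧ w < p ∧ ∀ t : ℚ, t.den ≤ z ^ 2 → t.den ≠ 1 →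
      (∀ r : ℕ, r.Prime → r ∣ t.den → w < r) → |x - y + t| < δ → p ∣ t.den := by
  by_cases h : ∃ t : ℚ, t.den ≤ z ^ 2 ∧ t.den ≠ 1 ∧
      (∀ r : ℕ, r.Prime → r ∣ t.den → w < r) ∧ |x - y + t| < δ
  · obtain ⟨t, h1, h2, h3, h4⟩ := h
    -- Two such rationals would lie within 2δ of each other, so there is only one; any prime factor
    -- of its denominator serves.
    refine ⟨t.den.minFac, Nat.minFac_prime h2, h3 _ (Nat.minFac_prime h2) (Nat.minFac_dvd _), ?_⟩
    intro t' h1' _ _ h4'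
    have : t = t' := by
      refine rat_eq_of_abs_sub_lt hδ h1 h1' ?_
      calc |(t : ℝ) - t'| = |(x - y + t) - (x - y + t')| := by ring_nf
        _ ≤ |x - y + t| + |x - y + t'| := abs_sub _ _
        _ < 2 * δ := by linarith
    rw [← this]
    exact Nat.minFac_dvd _
  · push Not at h
    -- No rational is concerned, so any prime above w will do.
    obtain ⟨p, hp, hp'⟩ := Nat.exists_infinite_primes (w + 1)
    refine ⟨p, hp', hp, fun t h1 h2 h3 h4 => ?_⟩
    have := h t h1 h2 h3
    linarith

theorem sum_biUnion_le_sum_sum {ι κ : Type*} [DecidableEq κ] (S : Finset ι) (T : ι → Finset κ)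
    {f : κ → ℝ} (hf : ∀ k, 0 ≤ f k) : ∑ k ∈ S.biUnion T, f k ≤ ∑ i ∈ S, ∑ k ∈ T i, f k := by
  classical
  induction S using Finset.induction_on with
  | empty => simp
  | insert i S hi ih =>
    rw [Finset.biUnion_insert, Finset.sum_insert hi]
    have h1 := Finset.sum_union_inter (s₁ := T i) (s₂ := S.biUnion T) (f := f)
    have h2 : 0 ≤ ∑ k ∈ T i ∩ S.biUnion T, f k := Finset.sum_nonneg fun k _ => hf k
    linarith

theorem den_natCast_div_dvd (a q : ℕ) : ((a : ℚ) / q).den ∣ q := by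
  have := Rat.den_dvd (a : ℤ) (q : ℤ)
  rw [Rat.divInt_eq_div, Int.cast_natCast, Int.cast_natCast] at this
  exact Int.natCast_dvd_natCast.1 this

/-! ### The large sieve for primes at few points. -/

/-- The large sieve inequality for primes at few well-separated points. -/
theorem sum_sq_trigPoly_primes_le {N M : ℝ} (hN : 1 < N) {z : ℕ} (hz1 : (z : ℝ) ^ 4 ≤ N)
    (hz2 : N ≤ (z : ℝ) ^ 8) {s : Finset ℕ}
    (hs : ∀ n ∈ s, n.Prime ∧ z < n ∧ M ≤ n ∧ (n : ℝ) ≤ M + N) (u : ℕ → ℂ) {X : Finset ℝ}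
    (hX : X.Nonempty)
    (hsep : ∀ x ∈ X, ∀ y ∈ X, x ≠ y → ∀ m : ℤ, 1 / (6 * N) ≤ |x - y - m|) :
    ∑ x ∈ X, ‖trigPoly s u x‖ ^ 2 ≤
      2304 * Real.exp 6 * (N / Real.log N) * Real.log (4 * X.card) * ∑ n ∈ s, ‖u n‖ ^ 2 := by
  set δ : ℝ := 1 / (6 * N) with hδ
  have hN0 : 0 < N := by linarith
  have hδz : 2 * δ * (z : ℝ) ^ 4 ≤ 1 := by
    calc 2 * δ * (z : ℝ) ^ 4 ≤ 2 * δ * N := mul_le_mul_of_nonneg_left hz1 (by positivity)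
      _ = 1 / 3 := by rw [hδ]; field_simp; norm_num
      _ ≤ 1 := by norm_num
  set K := X.card with hK
  have hK1 : 1 ≤ K := hX.card_pos
  -- For each x at most 2K primes are excluded, each above w and thus carrying at most G/w of the
  -- sieve sum; with w = 4K at most half is lost.
  set w := 4 * K with hw
  choose P hPprime hPw hP using exists_prime_dvd_den hδz w
  -- If x+a/q and y+b/q' nearly collide modulo 1, `P x y` divides qq' unless the rational offset is
  -- an integer. It may divide either factor, so both orders of the pair are excluded.
  set Q : ℝ → Finset ℕ := fun x =>
    (sieveModuli w z).filter fun q => ∀ y ∈ X, ¬ P x y ∣ q ∧ ¬ P y x ∣ q with hQ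
  set G : ℝ := ∑ q ∈ sieveModuli w z, 1 / (q.totient : ℝ) with hG
  have hG0 : 0 ≤ G := Finset.sum_nonneg fun _ _ => by positivity
  have hQsum : ∀ x, G / 2 ≤ ∑ q ∈ Q x, 1 / (q.totient : ℝ) := by
    intro x
    have hsplit := Finset.sum_filter_add_sum_filter_not (sieveModuli w z)
      (fun q => ∀ y ∈ X, ¬ P x y ∣ q ∧ ¬ P y x ∣ q) (fun q => 1 / (q.totient : ℝ))
    have hbad : ∑ q ∈ sieveModuli w z with ¬ (∀ y ∈ X, ¬ P x y ∣ q ∧ ¬ P y x ∣ q),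
        1 / (q.totient : ℝ) ≤ ∑ y ∈ X, 2 * (G / w) := by
      calc ∑ q ∈ sieveModuli w z with ¬ (∀ y ∈ X, ¬ P x y ∣ q ∧ ¬ P y x ∣ q),
            1 / (q.totient : ℝ)
          ≤ ∑ q ∈ X.biUnion fun y => (sieveModuli w z).filter (P x y ∣ ·) ∪
              (sieveModuli w z).filter (P y x ∣ ·), 1 / (q.totient : ℝ) := by
            refine Finset.sum_le_sum_of_subset_of_nonneg ?_ fun _ _ _ => by positivity
            intro q hq
            rw [Finset.mem_filter] at hq
            obtain ⟨hq1, hq2⟩ := hq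
            push Not at hq2
            obtain ⟨y, hy, h⟩ := hq2
            rw [Finset.mem_biUnion]
            refine ⟨y, hy, ?_⟩
            rw [Finset.mem_union, Finset.mem_filter, Finset.mem_filter]
            tauto
        _ ≤ ∑ y ∈ X, ∑ q ∈ (sieveModuli w z).filter (P x y ∣ ·) ∪
              (sieveModuli w z).filter (P y x ∣ ·), 1 / (q.totient : ℝ) :=
            sum_biUnion_le_sum_sum _ _ fun _ => by positivity
        _ ≤ ∑ y ∈ X, 2 * (G / w) := by
            refine Finset.sum_le_sum fun y _ => ?_
            have hw0 : (0 : ℝ) < w := by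
              have : 0 < w := by omega
              exact_mod_cast this
            have h1 := sum_sieveModuli_dvd_le w z (hPprime x y) (hPw x y)
            have h2 := sum_sieveModuli_dvd_le w z (hPprime y x) (hPw y x)
            rw [← le_div_iff₀' hw0] at h1 h2
            have h3 := Finset.sum_union_inter (s₁ := (sieveModuli w z).filter (P x y ∣ ·))
              (s₂ := (sieveModuli w z).filter (P y x ∣ ·)) (f := fun q => 1 / (q.totient : ℝ))
            have h4 : 0 ≤ ∑ q ∈ (sieveModuli w z).filter (P x y ∣ ·) ∩
              (sieveModuli w z).filter (P y x ∣ ·), 1 / (q.totient : ℝ) :=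
              Finset.sum_nonneg fun _ _ => by positivity
            linarith
    have hbad2 : ∑ y ∈ X, 2 * (G / w) = G / 2 := by
      rw [Finset.sum_const, nsmul_eq_mul, ← hK, hw]
      have : (K : ℝ) ≠ 0 := by
        have : K ≠ 0 := by omega
        exact_mod_cast this
      push_cast
      field_simp
      ring
    rw [hbad2] at hbad
    change G / 2 ≤ ∑ q ∈ (sieveModuli w z).filter fun q => ∀ y ∈ X, ¬ P x y ∣ q ∧ ¬ P y x ∣ q,
      1 / (q.totient : ℝ)
    linarith
  set I : Finset (Σ _ : ℝ, Σ _ : ℕ, ℕ) := X.sigma fun x => (Q x).sigma numerators with hI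
  have hsieve : ∑ i ∈ I, ‖trigPoly s u (i.1 + (i.2.2 : ℝ) / i.2.1)‖ ^ 2
      ≤ 48 * N * ∑ n ∈ s, ‖u n‖ ^ 2 := by
    refine large_sieve I (fun i => i.1 + (i.2.2 : ℝ) / i.2.1) hN.le s
      (fun n hn => (hs n hn).2.2) u ?_
    rintro ⟨x, q, a⟩ hi ⟨y, q', b⟩ hj hij m
    rw [hI, Finset.mem_sigma, Finset.mem_sigma] at hi hj
    obtain ⟨hx, hq, ha⟩ := hi
    obtain ⟨hy, hq', hb⟩ := hj
    simp only at hx hq ha hy hq' hb ⊢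
    rw [← hδ]
    by_contra hlt
    push Not at hlt
    rw [hQ, Finset.mem_filter] at hq hq'
    set t : ℚ := (a : ℚ) / q - (b : ℚ) / q' - m with ht
    have htx : |x - y + t| < δ := by
      refine lt_of_eq_of_lt ?_ hlt
      rw [ht]
      push_cast
      ring_nf
    -- Integral offset: the fractions coincide, so x ≠ y and the spacing of X is contradicted.
    -- Otherwise `P x y` divides q or q', which the choice of `Q` forbids.
    by_cases hden : t.den = 1
    · obtain ⟨rfl, rfl⟩ := numerators_div_eq_of_isInt ha hb hden
      have hxy : x ≠ y := by
        rintro rfl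
        exact hij rfl
      have := hsep x hx y hy hxy m
      rw [ht] at htx
      push_cast at htx
      have e : x - y + ((a : ℝ) / q - (a : ℝ) / q - m) = x - y - m := by ring
      rw [e] at htx
      linarith
    · have hdvd : t.den ∣ q * q' := by
        have h1 : t.den ∣ ((a : ℚ) / q - (b : ℚ) / q').den * (m : ℚ).den := Rat.sub_den_dvd _ _
        rw [Rat.den_intCast, mul_one] at h1
        exact h1.trans ((Rat.sub_den_dvd _ _).trans 
          (mul_dvd_mul (den_natCast_div_dvd _ _) (den_natCast_div_dvd _ _)))
      obtain ⟨⟨hq1, hqz⟩, -, hqw⟩ := mem_sieveModuli.1 hq.1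
      obtain ⟨⟨hq1', hqz'⟩, -, hqw'⟩ := mem_sieveModuli.1 hq'.1
      have hdz : t.den ≤ z ^ 2 := by
        rw [sq]
        exact (Nat.le_of_dvd (Nat.mul_pos hq1 hq1') hdvd).trans (Nat.mul_le_mul hqz hqz')
      have hrough : ∀ r : ℕ, r.Prime → r ∣ t.den → w < r := by
        intro r hr hrt
        rcases (hr.dvd_mul).1 (hrt.trans hdvd) with h | h
        · exact hqw r (Nat.mem_primeFactors.2 ⟨hr, h, by omega⟩)
        · exact hqw' r (Nat.mem_primeFactors.2 ⟨hr, h, by omega⟩)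
      have hp := hP x y t hdz hden hrough htx
      rcases ((hPprime x y).dvd_mul).1 (hp.trans hdvd) with h | h
      · exact (hq.2 y hy).1 h
      · exact (hq'.2 x hx).2 h
  have hlower : G / 2 * ∑ x ∈ X, ‖trigPoly s u x‖ ^ 2 ≤
      ∑ i ∈ I, ‖trigPoly s u (i.1 + (i.2.2 : ℝ) / i.2.1)‖ ^ 2 := by
    rw [hI, Finset.sum_sigma, Finset.mul_sum]
    refine Finset.sum_le_sum fun x _ => ?_
    rw [Finset.sum_sigma]
    refine (mul_le_mul_of_nonneg_right (hQsum x) (by positivity)).trans ?_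
    rw [Finset.sum_mul]
    refine Finset.sum_le_sum fun q hq => ?_
    obtain ⟨⟨hq1, hqz⟩, hsq, -⟩ := mem_sieveModuli.1 (Finset.mem_filter.1 hq).1
    have hcop : ∀ n ∈ s, n.Coprime q := by
      intro n hn
      obtain ⟨hn1, hn2, -⟩ := hs n hn
      exact (Nat.Prime.coprime_iff_not_dvd hn1).2 fun h => by
        have := Nat.le_of_dvd hq1 h
        omega
    -- Cauchy–Schwarz over the φ(q) numerators loses exactly the factor φ(q) that the weight 1/φ(q)
    -- absorbs.
    have h1 := norm_trigPoly_le_sum u hsq hcop x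
    have h2 := sq_sum_le_card_mul_sum_sq (s := numerators q)
      (f := fun a => ‖trigPoly s u (x + (a : ℝ) / q)‖)
    rw [card_numerators] at h2
    have h3 : (0 : ℝ) < q.totient := by exact_mod_cast Nat.totient_pos.2 hq1
    rw [one_div, inv_mul_le_iff₀ h3]
    exact (pow_le_pow_left₀ (norm_nonneg _) h1 2).trans h2
  have hz0 : 1 < z := by
    by_contra h
    have : (z : ℝ) ≤ 1 := by exact_mod_cast not_lt.1 h
    have := pow_le_one₀ (n := 8) (Nat.cast_nonneg z) this
    linarith
  have hlogN : 0 < Real.log N := Real.log_pos hN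
  have hlogz : Real.log N ≤ 8 * Real.log z := by
    have := Real.log_le_log hN0 hz2
    rwa [Real.log_pow] at this
  have hmert : Real.log z ≤ 3 * Real.exp 6 * Real.log (4 * K) * G := by
    have h1 := log_le_prod_mul_sum w (z := z) (y := z) (by positivity) (by linarith)
    refine h1.trans (mul_le_mul_of_nonneg_right ?_ hG0)
    have h2 := prod_primes_le (y := w) (by omega)
    refine h2.trans (le_of_eq ?_)
    rw [hw]
    push_cast
    rfl
  set T : ℝ := ∑ x ∈ X, ‖trigPoly s u x‖ ^ 2 with hT
  have hT0 : 0 ≤ T := Finset.sum_nonneg fun _ _ => by positivity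
  set U : ℝ := ∑ n ∈ s, ‖u n‖ ^ 2 with hU
  have hL0 : 0 ≤ Real.log (4 * K) := by
    apply Real.log_nonneg
    have : (1 : ℝ) ≤ K := by exact_mod_cast hK1
    linarith
  have hGT : G * T ≤ 96 * N * U := by linarith
  have hfin : Real.log N * T ≤ 2304 * Real.exp 6 * N * Real.log (4 * K) * U := by
    calc Real.log N * T ≤ (8 * (3 * Real.exp 6 * Real.log (4 * K) * G)) * T :=
          mul_le_mul_of_nonneg_right (by linarith) hT0
      _ = (24 * Real.exp 6 * Real.log (4 * K)) * (G * T) := by ring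
      _ ≤ (24 * Real.exp 6 * Real.log (4 * K)) * (96 * N * U) :=
          mul_le_mul_of_nonneg_left hGT (by positivity)
      _ = _ := by ring
  rw [← le_div_iff₀' hlogN] at hfin
  refine hfin.trans (le_of_eq ?_)
  field_simp

/-! ### Majorization. -/

/-- A convex function lies above its tangent line at x; for x > 0 this is Bernoulli's inequality at
b/x. -/
theorem rpow_tangent_le {x b η : ℝ} (hx : 0 ≤ x) (hb : 0 ≤ b) (hη : 0 ≤ η) :
    x ^ (1 + η) + (1 + η) * x ^ η * (b - x) ≤ b ^ (1 + η) := by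
  rcases hx.eq_or_lt with rfl | hx
  · rcases hη.eq_or_lt with rfl | hη
    · simp
    · rw [Real.zero_rpow (by linarith), Real.zero_rpow hη.ne']
      simp only [mul_zero, zero_mul, add_zero]
      positivity
  · have h := one_add_mul_self_le_rpow_one_add (s := b / x - 1) (p := 1 + η)
      (by linarith [div_nonneg hb hx.le]) (by linarith)
    have e : 1 + (b / x - 1) = b / x := by ring
    rw [e, Real.div_rpow hb hx.le, le_div_iff₀ (by positivity)] at h
    refine le_trans (le_of_eq ?_) h
    rw [Real.rpow_add hx, Real.rpow_one]
    field_simp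

/-- A majorization inequality for the convex function `x ↦ x ^ (1 + η)`. -/
theorem sum_rpow_le_of_forall_subset {ι : Type*} (X : Finset ι) {s : ι → ℝ} (hs : ∀ i, 0 ≤ s i)
    {b : ℕ → ℝ} (hb : ∀ k, 0 ≤ b k) {η : ℝ} (hη : 0 ≤ η)
    (h : ∀ Y ⊆ X, ∑ i ∈ Y, s i ≤ ∑ k ∈ Finset.range Y.card, b k) :
    ∑ i ∈ X, s i ^ (1 + η) ≤ ∑ k ∈ Finset.range X.card, b k ^ (1 + η) := by
  classical
  -- Strengthened for induction by adding the slack of the partial sums, weighted by the tangent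
  -- slope at a lower bound m of the values. Removing the smallest value `s a` allows the slope to
  -- rise from m to `s a`, since the slack is nonnegative.
  have key : (∀ Y ⊆ X, ∑ i ∈ Y, s i ≤ ∑ k ∈ Finset.range Y.card, b k) →
      ∀ m : ℝ, 0 ≤ m → (∀ i ∈ X, m ≤ s i) →
      ∑ i ∈ X, s i ^ (1 + η) + (1 + η) * m ^ η *
        (∑ k ∈ Finset.range X.card, b k - ∑ i ∈ X, s i) ≤
      ∑ k ∈ Finset.range X.card, b k ^ (1 + η) := by
    clear h
    induction X using Finset.induction_on_min_value s with
    | empty => simp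
    | insert a X ha hmin ih =>
      intro h m hm hma
      have hih := ih (fun Y hY => h Y (hY.trans (Finset.subset_insert _ _))) (s a) (hs a) hmin
      have hD := h _ (Finset.Subset.refl _)
      rw [Finset.card_insert_of_notMem ha, Finset.sum_range_succ, Finset.sum_insert ha] at hD
      rw [Finset.card_insert_of_notMem ha, Finset.sum_range_succ, Finset.sum_range_succ,
        Finset.sum_insert ha, Finset.sum_insert ha]
      have ht := rpow_tangent_le (hs a) (hb X.card) hη
      have hmono : m ^ η ≤ s a ^ η :=
        Real.rpow_le_rpow hm (hma a (Finset.mem_insert_self _ _)) hη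
      have hmul := mul_le_mul_of_nonneg_right (mul_le_mul_of_nonneg_left hmono
        (by linarith : 0 ≤ 1 + η)) (sub_nonneg.2 hD)
      linarith
  by_cases hX : X.Nonempty
  · have h1 := key h 0 le_rfl (fun i _ => hs i)
    have h2 := h X (Finset.Subset.refl _)
    have h3 : 0 ≤ (1 + η) * (0 : ℝ) ^ η *
        (∑ k ∈ Finset.range X.card, b k - ∑ i ∈ X, s i) :=
      mul_nonneg (mul_nonneg (by linarith) (Real.rpow_nonneg le_rfl _)) (sub_nonneg.2 h2)
    linarith
  · rw [Finset.not_nonempty_iff_eq_empty.1 hX]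
    simp

/-- Moments of a finite family whose partial sums grow at most logarithmically. -/
theorem sum_rpow_le_of_log {ι : Type*} (X : Finset ι) {s : ι → ℝ} (hs : ∀ i, 0 ≤ s i) {A : ℝ}
    (hA : 0 ≤ A) {η : ℝ} (hη : 0 ≤ η)
    (h : ∀ Y ⊆ X, Y.Nonempty → ∑ i ∈ Y, s i ≤ A * Real.log (4 * Y.card)) :
    ∑ i ∈ X, s i ^ (1 + η) ≤ A ^ (1 + η) *
      (Real.log 4 ^ (1 + η) + ∑ k ∈ Finset.Icc 1 X.card, (k : ℝ) ^ (-(1 + η))) := by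
  -- Increments of the bound A log(4K): the first is A log 4, the later ones A log(1 + 1/k) ≤ A/k.
  set b : ℕ → ℝ := fun k => A * (Real.log (4 * (k + 1 : ℕ)) - if k = 0 then 0 else
    Real.log (4 * k)) with hb
  have hlog4 : 0 ≤ Real.log 4 := Real.log_nonneg (by norm_num)
  have hb0 : b 0 = A * Real.log 4 := by simp [hb]
  have hbs : ∀ k : ℕ, b (k + 1) = A * Real.log (1 + 1 / (k + 1 : ℕ)) := by
    intro k
    have h1 : (0 : ℝ) < (k + 1 : ℕ) := by positivity
    simp only [hb, Nat.add_eq_zero_iff, one_ne_zero, and_false, if_false]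
    rw [← Real.log_div (by positivity) (by positivity)]
    congr 2
    push_cast
    field_simp
  have hbnn : ∀ k, 0 ≤ b k := by
    intro k
    rcases k with _ | k
    · rw [hb0]
      positivity
    · rw [hbs]
      refine mul_nonneg hA (Real.log_nonneg ?_)
      have : (0 : ℝ) ≤ 1 / (k + 1 : ℕ) := by positivity
      linarith
  have hsum : ∀ K : ℕ, ∑ k ∈ Finset.range (K + 1), b k = A * Real.log (4 * (K + 1 : ℕ)) := by
    intro K
    induction K with
    | zero => simp [hb0]
    | succ K ih =>
      rw [Finset.sum_range_succ, ih]
      simp only [hb, Nat.add_eq_zero_iff, one_ne_zero, and_false, if_false]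
      ring
  refine (sum_rpow_le_of_forall_subset X hs hbnn hη ?_).trans ?_
  · intro Y hY
    rcases Y.eq_empty_or_nonempty with rfl | hne
    · simp
    · obtain ⟨K, hK⟩ := Nat.exists_eq_add_of_lt hne.card_pos
      rw [zero_add] at hK
      have := h Y hY hne
      rw [hK] at this ⊢
      rw [hsum]
      exact this
  · have hA' : 0 ≤ A ^ (1 + η) := by positivity
    rw [mul_add, ← Real.mul_rpow hA hlog4]
    rcases X.card with _ | K
    · simp only [Finset.range_zero, Finset.sum_empty]
      positivity
    rw [Finset.sum_range_succ', hb0, add_comm]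
    refine add_le_add_right ?_ _
    calc ∑ k ∈ Finset.range K, b (k + 1) ^ (1 + η)
        ≤ ∑ k ∈ Finset.range K, A ^ (1 + η) * ((k + 1 : ℕ) : ℝ) ^ (-(1 + η)) := by
          refine Finset.sum_le_sum fun k _ => ?_
          have h1 : (0 : ℝ) < (k + 1 : ℕ) := by positivity
          have h2 : b (k + 1) ≤ A * ((k + 1 : ℕ) : ℝ)⁻¹ := by
            rw [hbs]
            refine mul_le_mul_of_nonneg_left ?_ hA
            have := Real.log_le_sub_one_of_pos (x := 1 + 1 / ((k + 1 : ℕ) : ℝ)) (by positivity)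
            rw [← one_div]
            linarith
          refine (Real.rpow_le_rpow (hbnn _) h2 (by linarith)).trans (le_of_eq ?_)
          rw [Real.mul_rpow hA (by positivity), Real.inv_rpow h1.le, Real.rpow_neg h1.le]
      _ = A ^ (1 + η) * ∑ k ∈ Finset.Icc 1 K, (k : ℝ) ^ (-(1 + η)) := by
          rw [← Finset.mul_sum, Finset.range_eq_Ico,
            Finset.sum_Ico_add' (fun k : ℕ => (k : ℝ) ^ (-(1 + η))) 0 K 1]
          rfl
      _ ≤ A ^ (1 + η) * ∑ k ∈ Finset.Icc 1 (K + 1), (k : ℝ) ^ (-(1 + η)) := by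
          refine mul_le_mul_of_nonneg_left ?_ hA'
          exact Finset.sum_le_sum_of_subset_of_nonneg
            (Finset.Icc_subset_Icc_right (Nat.le_succ K)) fun _ _ _ => by positivity

/-! ### Upper bound for the moments. -/

/-- The level is ⌊N^(1/4)⌋. The bound z⁴ ≤ N gives the spacing of fractions, N ≤ z⁸ gives log z ≥
(log N)/8, and z ≤ √N puts the primes of the interval above z. -/
theorem exists_sieve_level {N : ℝ} (hN : (10 : ℝ) ^ 6 ≤ N) :
    ∃ z : ℕ, 1 ≤ z ∧ (z : ℝ) ^ 4 ≤ N ∧ N ≤ (z : ℝ) ^ 8 ∧ (z : ℝ) ≤ Real.sqrt N := by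
  set w := Real.sqrt (Real.sqrt N) with hw
  have hN0 : 0 ≤ N := by linarith [pow_nonneg (by norm_num : (0 : ℝ) ≤ 10) 6]
  have hw2 : w ^ 2 = Real.sqrt N := Real.sq_sqrt (Real.sqrt_nonneg _)
  have hw4 : w ^ 4 = N := by
    rw [show w ^ 4 = (w ^ 2) ^ 2 by ring, hw2, Real.sq_sqrt hN0]
  have hw3 : 3 ≤ w := by
    by_contra h
    push Not at h
    have := pow_le_pow_left₀ (Real.sqrt_nonneg _) h.le 4
    rw [hw4] at this
    linarith [show (3 : ℝ) ^ 4 < 10 ^ 6 by norm_num]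
  have h1 : (⌊w⌋₊ : ℝ) ≤ w := Nat.floor_le (by linarith)
  have h2 : w < ⌊w⌋₊ + 1 := Nat.lt_floor_add_one w
  have h3 : w ≤ (⌊w⌋₊ : ℝ) ^ 2 := by nlinarith
  refine ⟨⌊w⌋₊, ?_, ?_, ?_, ?_⟩
  · exact Nat.le_floor (by push_cast; linarith)
  · rw [← hw4]
    exact pow_le_pow_left₀ (by positivity) h1 4
  · rw [← hw4, show (⌊w⌋₊ : ℝ) ^ 8 = ((⌊w⌋₊ : ℝ) ^ 2) ^ 4 by ring]
    exact pow_le_pow_left₀ (by linarith) h3 4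
  · rw [← hw2]
    nlinarith

/-- Folds the unit interval so that the integrand becomes a sum over points spaced by 1/L, to which
discrete bounds apply. -/
theorem integral_eq_integral_sum {g : ℝ → ℝ} (hg : Continuous g) {L : ℕ} (hL : 0 < L) :
    ∫ t in (0 : ℝ)..1, g t =
      ∫ t in (0 : ℝ)..1 / L, ∑ j ∈ Finset.range L, g (t + (j : ℝ) / L) := by
  have hL' : (L : ℝ) ≠ 0 := by positivity
  have h := intervalIntegral.sum_integral_adjacent_intervals (μ := MeasureTheory.volume)
    (f := g) (a := fun j : ℕ => (j : ℝ) / L) (n := L)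
    (fun k _ => hg.intervalIntegrable _ _)
  simp only [Nat.cast_zero, zero_div, div_self hL'] at h
  rw [← h, intervalIntegral.integral_finsetSum]
  · refine Finset.sum_congr rfl fun j _ => ?_
    rw [intervalIntegral.integral_comp_add_right (fun t => g t)]
    congr 1
    · ring
    · push_cast
      ring
  · intro j _
    exact (hg.comp (continuous_id.add continuous_const)).intervalIntegrable _ _

/-- An upper bound for the moments of a trigonometric polynomial over primes. -/
theorem integral_rpow_trigPoly_primes_le {N M : ℝ} (hN : 1 < N) {z : ℕ} (hz1 : (z : ℝ) ^ 4 ≤ N)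
    (hz2 : N ≤ (z : ℝ) ^ 8) {s : Finset ℕ}
    (hs : ∀ n ∈ s, n.Prime ∧ z < n ∧ M ≤ n ∧ (n : ℝ) ≤ M + N) (u : ℕ → ℂ) {A η : ℝ}
    (hη : 0 ≤ η)
    (hA : 2304 * Real.exp 6 * (N / Real.log N) * ∑ n ∈ s, ‖u n‖ ^ 2 ≤ A) :
    ∫ t in (0 : ℝ)..1, ‖trigPoly s u t‖ ^ (2 * (1 + η)) ≤ 2 / N * (A ^ (1 + η) *
      (Real.log 4 ^ (1 + η) + ∑ k ∈ Finset.Icc 1 ⌊N⌋₊, (k : ℝ) ^ (-(1 + η)))) := by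
  set L := ⌊N⌋₊ with hLdef
  have hL : 0 < L := Nat.floor_pos.2 hN.le
  have hL0 : (0 : ℝ) < L := by exact_mod_cast hL
  have hL1 : (1 : ℝ) ≤ L := by exact_mod_cast hL
  have hLN : (L : ℝ) ≤ N := Nat.floor_le (by linarith)
  have hNL : N < L + 1 := Nat.lt_floor_add_one N
  have hlogN := Real.log_pos hN
  have hA0 : 0 ≤ A := by
    refine le_trans ?_ hA
    have : 0 ≤ ∑ n ∈ s, ‖u n‖ ^ 2 := Finset.sum_nonneg fun _ _ => by positivity
    positivity
  set B := A ^ (1 + η) *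
      (Real.log 4 ^ (1 + η) + ∑ k ∈ Finset.Icc 1 L, (k : ℝ) ^ (-(1 + η))) with hB
  have hB0 : 0 ≤ B := by
    have h1 : 0 ≤ ∑ k ∈ Finset.Icc 1 L, (k : ℝ) ^ (-(1 + η)) :=
      Finset.sum_nonneg fun _ _ => by positivity
    have h2 : 0 ≤ Real.log 4 := Real.log_nonneg (by norm_num)
    positivity
  have hcont : Continuous fun t => ‖trigPoly s u t‖ ^ (2 * (1 + η)) :=
    (continuous_trigPoly s u).norm.rpow_const fun _ => Or.inr (by linarith)
  rw [integral_eq_integral_sum hcont hL]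
  have hpt : ∀ t : ℝ, ∑ j ∈ Finset.range L, ‖trigPoly s u (t + (j : ℝ) / L)‖ ^ (2 * (1 + η))
      ≤ B := by
    intro t
    have e : ∀ j : ℕ, ‖trigPoly s u (t + (j : ℝ) / L)‖ ^ (2 * (1 + η))
        = (‖trigPoly s u (t + (j : ℝ) / L)‖ ^ 2) ^ (1 + η) := by
      intro j
      rw [Real.rpow_mul (norm_nonneg _), Real.rpow_two]
    simp only [e]
    have h := sum_rpow_le_of_log (Finset.range L)
      (s := fun j : ℕ => ‖trigPoly s u (t + (j : ℝ) / L)‖ ^ 2) (fun _ => by positivity) hA0 hη ?_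
    · rw [Finset.card_range] at h
      exact h
    · intro Y hY hne
      have hinj : Set.InjOn (fun j : ℕ => t + (j : ℝ) / L) (Y : Set ℕ) := by
        intro i _ j _ hij
        simp only [add_right_inj] at hij
        rw [div_left_inj' hL0.ne'] at hij
        exact_mod_cast hij
      have hmain := sum_sq_trigPoly_primes_le hN hz1 hz2 hs u
        (X := Y.image fun j : ℕ => t + (j : ℝ) / L) (hne.image _) ?_
      · rw [Finset.sum_image hinj, Finset.card_image_of_injOn hinj] at hmain
        refine hmain.trans ?_
        have hlog : 0 ≤ Real.log (4 * (Y.card : ℝ)) := by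
          apply Real.log_nonneg
          have : (1 : ℝ) ≤ Y.card := by exact_mod_cast hne.card_pos
          linarith
        refine le_trans (le_of_eq ?_) (mul_le_mul_of_nonneg_right hA hlog)
        ring
      · intro x hx y hy hxy m
        obtain ⟨i, hi, rfl⟩ := Finset.mem_image.1 hx
        obtain ⟨j, hj, rfl⟩ := Finset.mem_image.1 hy
        have hiL := Finset.mem_range.1 (hY hi)
        have hjL := Finset.mem_range.1 (hY hj)
        have hij : i ≠ j := fun h => hxy (by rw [h])
        have hne0 : (i : ℤ) - j - m * L ≠ 0 := by
          intro h0
          rcases lt_trichotomy m 0 with hm | hm | hm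
          · nlinarith
          · subst hm
            omega
          · nlinarith
        have h1 : (1 : ℝ) ≤ |(((i : ℤ) - j - m * L : ℤ) : ℝ)| := by
          exact_mod_cast Int.one_le_abs hne0
        have e2 : t + (i : ℝ) / L - (t + (j : ℝ) / L) - m
            = (((i : ℤ) - j - m * L : ℤ) : ℝ) / L := by
          push_cast
          field_simp
          ring
        rw [e2, abs_div, abs_of_pos hL0]
        calc 1 / (6 * N) ≤ 1 / (L : ℝ) := one_div_le_one_div_of_le hL0 (by linarith)
          _ ≤ _ := div_le_div_of_nonneg_right h1 hL0.le
  calc ∫ t in (0 : ℝ)..1 / L, ∑ j ∈ Finset.range L,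
        ‖trigPoly s u (t + (j : ℝ) / L)‖ ^ (2 * (1 + η))
      ≤ ∫ _ in (0 : ℝ)..1 / L, B := by
        refine intervalIntegral.integral_mono_on (by positivity) ?_
          (continuous_const.intervalIntegrable _ _) fun t _ => hpt t
        refine Continuous.intervalIntegrable ?_ _ _
        exact continuous_finsetSum _ fun j _ => hcont.comp (continuous_id.add continuous_const)
    _ = 1 / L * B := by
        rw [intervalIntegral.integral_const]
        simp
    _ ≤ 2 / N * B := by
        refine mul_le_mul_of_nonneg_right ?_ hB0
        rw [div_le_div_iff₀ hL0 (by linarith)]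
        linarith

/-! ### Lower bound for the moments. -/

/-- After factoring out e(Mt), all phases lie within a sixth of a turn, so no term has real part
below 1/2. -/
theorem half_card_le_norm_trigPoly {N M : ℝ} (hN : 0 < N) {s : Finset ℕ}
    (hs : ∀ n ∈ s, M ≤ n ∧ (n : ℝ) ≤ M + N) {t : ℝ} (h0 : 0 ≤ t) (h1 : t ≤ 1 / (6 * N)) :
    (s.card : ℝ) / 2 ≤ ‖trigPoly s (fun _ => 1) t‖ := by
  have e : expE (-(M * t)) * trigPoly s (fun _ => 1) t
      = ∑ n ∈ s, expE (((n : ℝ) - M) * t) := by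
    unfold trigPoly
    rw [Finset.mul_sum]
    refine Finset.sum_congr rfl fun n _ => ?_
    rw [one_mul, ← expE_add]
    ring_nf
  have h2 : ‖trigPoly s (fun _ => 1) t‖ = ‖∑ n ∈ s, expE (((n : ℝ) - M) * t)‖ := by
    rw [← e, norm_mul, norm_expE, one_mul]
  rw [h2]
  refine le_trans ?_ (Complex.re_le_norm _)
  rw [Complex.re_sum]
  calc (s.card : ℝ) / 2 = ∑ n ∈ s, (1 / 2 : ℝ) := by
        rw [Finset.sum_const, nsmul_eq_mul]
        ring
    _ ≤ _ := by
        refine Finset.sum_le_sum fun n hn => ?_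
        obtain ⟨h3, h4⟩ := hs n hn
        apply half_le_re_expE
        · exact mul_nonneg (by linarith) h0
        · calc ((n : ℝ) - M) * t ≤ N * (1 / (6 * N)) :=
                mul_le_mul (by linarith) h1 h0 hN.le
            _ = 1 / 6 := by field_simp

/-- A lower bound for the moments of the exponential sum over primes. -/
theorem le_integral_rpow_trigPoly_primes {N M : ℝ} (hN : 1 < N) {z : ℕ} (hz1 : (z : ℝ) ^ 4 ≤ N)
    {s : Finset ℕ}
    (hs : ∀ n ∈ s, n.Prime ∧ z < n ∧ M ≤ n ∧ (n : ℝ) ≤ M + N) {l : ℝ} (hl : 1 ≤ l) :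
    1 / (12 * N) * ((s.card : ℝ) / 2) ^ l *
        ∑ q ∈ sieveModuli 0 z, (q.totient : ℝ) ^ (1 - l) ≤
      ∫ t in (0 : ℝ)..1, ‖trigPoly s (fun _ => 1) t‖ ^ l := by
  set δ : ℝ := 1 / (6 * N) with hδ
  have hδ0 : 0 < δ := by positivity
  have hδ1 : δ ≤ 1 := by
    rw [hδ, div_le_one (by positivity)]
    linarith
  set S := trigPoly s (fun _ => 1) with hS
  have hcont : Continuous fun t => ‖S t‖ ^ l :=
    (continuous_trigPoly s _).norm.rpow_const fun _ => Or.inr (by linarith)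
  set I : Finset (Σ _ : ℕ, ℕ) := (sieveModuli 0 z).sigma numerators with hI
  -- The arcs of length δ starting at the fractions a/q do not overlap modulo 1: distinct fractions
  -- differ by at least 1/z² ≥ 1/N > δ.
  have harc := sum_integral_arc_le I (fun i => (i.2 : ℝ) / i.1) hδ0 hδ1 (fun t => ‖S t‖ ^ l) hcont
    (fun t => by positivity) (fun t m => by simp only [hS, trigPoly_add_int]) (by
      rintro ⟨q, a⟩ hi ⟨q', b⟩ hj hij m
      rw [hI, Finset.mem_sigma] at hi hj
      obtain ⟨hq, ha⟩ := hi
      obtain ⟨hq', hb⟩ := hj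
      simp only at hq ha hq' hb ⊢
      obtain ⟨⟨hq1, hqz⟩, -⟩ := mem_sieveModuli.1 hq
      obtain ⟨⟨hq1', hqz'⟩, -⟩ := mem_sieveModuli.1 hq'
      set t : ℚ := (a : ℚ) / q - (b : ℚ) / q' - m with ht
      have ht0 : t ≠ 0 := by
        intro h0
        obtain ⟨rfl, rfl⟩ := numerators_div_eq_of_isInt ha hb (m := m) (by
          rw [← ht, h0]
          rfl)
        exact hij rfl
      have h1 := one_div_den_le_abs ht0
      have h2 : t.den ≤ z ^ 4 := by
        have h3 : t.den ∣ ((a : ℚ) / q - (b : ℚ) / q').den * (m : ℚ).den := Rat.sub_den_dvd _ _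
        rw [Rat.den_intCast, mul_one] at h3
        have h4 := h3.trans ((Rat.sub_den_dvd _ _).trans
          (mul_dvd_mul (den_natCast_div_dvd a q) (den_natCast_div_dvd b q')))
        calc t.den ≤ q * q' := Nat.le_of_dvd (Nat.mul_pos hq1 hq1') h4
          _ ≤ z * z := Nat.mul_le_mul hqz hqz'
          _ = z ^ 2 := by ring
          _ ≤ z ^ 4 := Nat.pow_le_pow_right (by omega) (by norm_num)
      have h5 : (t.den : ℝ) ≤ N := le_trans (by exact_mod_cast h2) hz1
      have h6 : (0 : ℝ) < t.den := by exact_mod_cast t.den_pos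
      have e : (t : ℝ) = (a : ℝ) / q - (b : ℝ) / q' - m := by
        rw [ht]
        push_cast
        rfl
      rw [← e]
      refine le_trans ?_ h1
      rw [hδ]
      exact one_div_le_one_div_of_le h6 (by linarith))
  have hlow : ∑ q ∈ sieveModuli 0 z, δ * (((s.card : ℝ) / 2) ^ l * (q.totient : ℝ) ^ (1 - l)) ≤
      ∑ i ∈ I, ∫ t in (0 : ℝ)..δ, ‖S ((i.2 : ℝ) / i.1 + t)‖ ^ l := by
    rw [hI, Finset.sum_sigma]
    refine Finset.sum_le_sum fun q hq => ?_
    obtain ⟨⟨hq1, hqz⟩, hsq, -⟩ := mem_sieveModuli.1 hq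
    have hcomp : ∀ a : ℕ, Continuous fun t => ‖S ((a : ℝ) / q + t)‖ ^ l := fun a =>
      hcont.comp (continuous_const.add continuous_id)
    rw [← intervalIntegral.integral_finsetSum fun a _ => (hcomp a).intervalIntegrable _ _]
    have hc : ∫ _ in (0 : ℝ)..δ, ((s.card : ℝ) / 2) ^ l * (q.totient : ℝ) ^ (1 - l)
        = δ * (((s.card : ℝ) / 2) ^ l * (q.totient : ℝ) ^ (1 - l)) := by
      rw [intervalIntegral.integral_const]
      simp
    rw [← hc]
    refine intervalIntegral.integral_mono_on hδ0.le (continuous_const.intervalIntegrable _ _)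
      ((continuous_finsetSum _ fun a _ => hcomp a).intervalIntegrable _ _) fun t ht => ?_
    have hcop : ∀ n ∈ s, n.Coprime q := by
      intro n hn
      obtain ⟨hn1, hn2, -⟩ := hs n hn
      exact (Nat.Prime.coprime_iff_not_dvd hn1).2 fun h => by
        have := Nat.le_of_dvd hq1 h
        omega
    have h1 := norm_trigPoly_le_sum (fun _ => 1) hsq hcop t
    have h2 := half_card_le_norm_trigPoly (by linarith : 0 < N) (fun n hn => (hs n hn).2.2)
      ht.1 ht.2
    -- The power mean inequality over the φ(q) numerators produces the weight φ(q)^(1-l).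
    have h3 := Real.rpow_sum_le_const_mul_sum_rpow (numerators q)
      (fun a => ‖S (t + (a : ℝ) / q)‖) hl
    simp only [abs_norm] at h3
    rw [card_numerators] at h3
    have hφ : (0 : ℝ) < q.totient := by exact_mod_cast Nat.totient_pos.2 hq1
    have h4 : ((s.card : ℝ) / 2) ^ l ≤ (q.totient : ℝ) ^ (l - 1) *
        ∑ a ∈ numerators q, ‖S (t + (a : ℝ) / q)‖ ^ l :=
      (Real.rpow_le_rpow (by positivity) (h2.trans h1) (by linarith)).trans h3
    have e : (q.totient : ℝ) ^ (1 - l) = ((q.totient : ℝ) ^ (l - 1))⁻¹ := by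
      rw [← Real.rpow_neg hφ.le]
      congr 1
      ring
    rw [e, ← div_eq_mul_inv, div_le_iff₀' (by positivity)]
    simpa only [add_comm] using h4
  have hfin := hlow.trans harc
  rw [← Finset.mul_sum, ← Finset.mul_sum] at hfin
  have e : 1 / (12 * N) = δ / 2 := by
    rw [hδ]
    field_simp
    norm_num
  rw [e]
  linarith

/-! ### Comparison of the two local sums. -/

/-- A lower bound for the singular series. -/
theorem le_sum_totient_rpow {z : ℕ} {η τ : ℝ} (hη : 0 ≤ η) (hτ : 0 ≤ τ) (hz : Real.exp τ ≤ z)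
    (h : η * τ ≤ 1 / 8) :
    3 / 4 * τ ≤ ∑ q ∈ sieveModuli 0 z, (q.totient : ℝ) ^ (1 - 2 * (1 + η)) := by
  -- Truncating at y = e^τ keeps φ(q)^(-2η) ≥ e^(-2ητ) ≥ 3/4, while ∑ 1/φ(q) over squarefree q ≤ y
  -- is at least log y = τ.
  set y := Real.exp τ with hy
  have hy0 : 0 < y := Real.exp_pos _
  have hlog := log_le_prod_mul_sum 0 (z := ⌊y⌋₊) hy0 (Nat.lt_floor_add_one y)
  have e0 : Nat.primesLE 0 = ∅ := by decide
  rw [e0, Finset.prod_empty, one_mul, hy, Real.log_exp, ← hy] at hlog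
  have hfloor : ⌊y⌋₊ ≤ z := Nat.floor_le_of_le hz
  calc 3 / 4 * τ ≤ y ^ (-(2 * η)) * τ := by
        refine mul_le_mul_of_nonneg_right ?_ hτ
        rw [hy, ← Real.exp_mul]
        have := Real.add_one_le_exp (τ * -(2 * η))
        nlinarith
    _ ≤ y ^ (-(2 * η)) * ∑ q ∈ sieveModuli 0 ⌊y⌋₊, 1 / (q.totient : ℝ) :=
        mul_le_mul_of_nonneg_left hlog (by positivity)
    _ ≤ ∑ q ∈ sieveModuli 0 ⌊y⌋₊, (q.totient : ℝ) ^ (1 - 2 * (1 + η)) := by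
        rw [Finset.mul_sum]
        refine Finset.sum_le_sum fun q hq => ?_
        obtain ⟨⟨hq1, hqz⟩, -⟩ := mem_sieveModuli.1 hq
        have hφ : (0 : ℝ) < q.totient := by exact_mod_cast Nat.totient_pos.2 hq1
        have hφy : (q.totient : ℝ) ≤ y := by
          refine le_trans ?_ (Nat.floor_le hy0.le)
          exact_mod_cast (Nat.totient_le q).trans hqz
        rw [show 1 - 2 * (1 + η) = -(2 * η) + -1 by ring, Real.rpow_add hφ, Real.rpow_neg_one,
          one_div]
        refine mul_le_mul_of_nonneg_right ?_ (by positivity)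
        exact Real.rpow_le_rpow_of_nonpos hφ hφy (by linarith)
    _ ≤ _ := by
        refine Finset.sum_le_sum_of_subset_of_nonneg ?_ fun _ _ _ => by positivity
        intro q hq
        rw [mem_sieveModuli] at hq ⊢
        exact ⟨⟨hq.1.1, hq.1.2.trans hfloor⟩, hq.2⟩

/-- Comparison of the two local sums. -/
theorem sum_rpow_le_sum_totient_rpow {N : ℝ} (hN : 1 < N) {z : ℕ} (hz1 : 1 ≤ z)
    (hz : N ≤ (z : ℝ) ^ 8) {η : ℝ} (hη : 0 ≤ η) :
    1 + ∑ k ∈ Finset.Icc 1 ⌊N⌋₊, (k : ℝ) ^ (-(1 + η)) ≤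
      14 * ∑ q ∈ sieveModuli 0 z, (q.totient : ℝ) ^ (1 - 2 * (1 + η)) := by
  set W := ∑ q ∈ sieveModuli 0 z, (q.totient : ℝ) ^ (1 - 2 * (1 + η)) with hW
  have hlogN := Real.log_pos hN
  have hN0 : 0 < N := by linarith
  have hW1 : 1 ≤ W := by
    have h1 : 1 ∈ sieveModuli 0 z :=
      mem_sieveModuli.2 ⟨⟨le_rfl, hz1⟩, squarefree_one, by simp⟩
    have := Finset.single_le_sum
      (f := fun q : ℕ => (q.totient : ℝ) ^ (1 - 2 * (1 + η))) (fun _ _ => by positivity) h1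
    simpa using this
  have hexp : ∀ τ : ℝ, τ ≤ Real.log N / 8 → Real.exp τ ≤ z := by
    intro τ hτ
    have hz0 : (0 : ℝ) < z := by exact_mod_cast hz1
    rw [← Real.le_log_iff_exp_le hz0]
    have := Real.log_le_log hN0 hz
    rw [Real.log_pow] at this
    push_cast at this
    linarith
  -- The left side is at most 2 + log N or 2 + 1/η. Taking τ = (log N)/8 or τ = 1/(8η) respectively,
  -- and using W ≥ 1 for the constant term, gives 2 + 32/3 ≤ 14.
  rcases le_or_gt (η * Real.log N) 1 with h | h
  · have hWτ := le_sum_totient_rpow hη (by positivity) (hexp _ le_rfl) (by linarith)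
    have hH : ∑ k ∈ Finset.Icc 1 ⌊N⌋₊, (k : ℝ) ^ (-(1 + η)) ≤ 1 + Real.log N := by
      calc ∑ k ∈ Finset.Icc 1 ⌊N⌋₊, (k : ℝ) ^ (-(1 + η))
          ≤ ∑ k ∈ Finset.Icc 1 ⌊N⌋₊, ((k : ℝ))⁻¹ := by
            refine Finset.sum_le_sum fun k hk => ?_
            rw [← Real.rpow_neg_one]
            refine Real.rpow_le_rpow_of_exponent_le ?_ (by linarith)
            exact_mod_cast (Finset.mem_Icc.1 hk).1
        _ ≤ 1 + Real.log ⌊N⌋₊ := by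
            have := harmonic_le_one_add_log ⌊N⌋₊
            rw [harmonic_eq_sum_Icc] at this
            push_cast at this
            exact this
        _ ≤ 1 + Real.log N := by
            have h1 : (0 : ℝ) < ⌊N⌋₊ := by exact_mod_cast Nat.floor_pos.2 hN.le
            linarith [Real.log_le_log h1 (Nat.floor_le hN0.le)]
    linarith
  · have hη0 : 0 < η := by
      by_contra h0
      have : η = 0 := le_antisymm (not_lt.1 h0) hη
      rw [this] at h
      linarith
    have hτ : 1 / (8 * η) ≤ Real.log N / 8 := by
      rw [div_le_div_iff₀ (by positivity) (by norm_num)]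
      nlinarith
    have hWτ := le_sum_totient_rpow hη (by positivity) (hexp _ hτ)
      (by rw [mul_one_div, div_le_div_iff₀ (by positivity) (by norm_num)]; linarith)
    have hH := sum_rpow_le hη0 ⌊N⌋₊
    have e : 1 / (8 * η) = 1 / 8 * (1 / η) := by
      rw [one_div_mul_one_div]
    rw [e] at hWτ
    linarith

/-! ### Conclusion. -/

theorem mainTheorem11 :
    ∃ C : ℝ, 0 < C ∧
      ∀ (N M l : ℝ) (u : ℕ → ℂ),
        (10 : ℝ) ^ 6 ≤ N → Real.sqrt N ≤ M → 2 ≤ l →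
        ∑ p ∈ primesInInterval M N, ‖u p‖ ^ 2 ≤ ((primesInInterval M N).card : ℝ) →
        (∫ α in (0 : ℝ)..1, ‖primeTrigPoly M N u α‖ ^ l) ^ (1 / l) ≤
          C * Real.sqrt ((N / Real.log N) / (1 + ((primesInInterval M N).card : ℝ))) *
            (∫ α in (0 : ℝ)..1, ‖primeTrigPoly M N (fun _ => 1) α‖ ^ l) ^ (1 / l) := by
  set c : ℝ := 2304 * Real.exp 6 with hc
  have hc0 : 0 < c := by positivity
  clear_value c
  refine ⟨336 * Real.sqrt (16 * c), by positivity, ?_⟩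
  intro N M l u hN hM hl hu
  have hN1 : 1 < N := lt_of_lt_of_le (by norm_num) hN
  have hN0 : 0 < N := by linarith
  have hlogN := Real.log_pos hN1
  have hl0 : 0 < l := by linarith
  obtain ⟨z, hz1, hz4, hz8, hzN⟩ := exists_sieve_level hN
  set s := primesInInterval M N with hsdef
  set R : ℝ := (s.card : ℝ) with hR
  have hs : ∀ n ∈ s, n.Prime ∧ z < n ∧ M ≤ n ∧ (n : ℝ) ≤ M + N := by
    intro n hn
    obtain ⟨h1, h2, h3⟩ := mem_primesInInterval.1 hn
    have h4 : (z : ℝ) < n := by linarith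
    exact ⟨h1, by exact_mod_cast h4, by linarith, h3⟩
  change (∫ α in (0 : ℝ)..1, ‖trigPoly s u α‖ ^ l) ^ (1 / l) ≤ _ *
    (∫ α in (0 : ℝ)..1, ‖trigPoly s (fun _ => 1) α‖ ^ l) ^ (1 / l)
  set Vu := ∫ α in (0 : ℝ)..1, ‖trigPoly s u α‖ ^ l with hVu
  set V := ∫ α in (0 : ℝ)..1, ‖trigPoly s (fun _ => 1) α‖ ^ l with hV
  have hV0 : 0 ≤ V := intervalIntegral.integral_nonneg (by norm_num) fun _ _ => by positivity
  have hVu0 : 0 ≤ Vu := intervalIntegral.integral_nonneg (by norm_num) fun _ _ => by positivity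
  -- The empty case is set apart because replacing R by 1 + R in the denominator costs a factor 2
  -- only once R ≥ 1.
  rcases s.eq_empty_or_nonempty with hemp | hne
  · have h0 : Vu = 0 := by
      rw [hVu, hemp]
      simp [trigPoly, Real.zero_rpow hl0.ne']
    rw [h0, Real.zero_rpow (by positivity)]
    positivity
  have hR1 : 1 ≤ R := by
    rw [hR]
    exact_mod_cast hne.card_pos
  clear_value R
  set η : ℝ := l / 2 - 1 with hη
  have hη0 : 0 ≤ η := by linarith
  have hlη : l = 2 * (1 + η) := by rw [hη]; ring
  clear_value η
  set A : ℝ := c * (N / Real.log N) * R with hA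
  have hA0 : 0 ≤ A := by positivity
  clear_value A
  have hup := integral_rpow_trigPoly_primes_le hN1 hz4 hz8 hs u (A := A) hη0
    (by rw [← hc, hA]; exact mul_le_mul_of_nonneg_left hu (by positivity))
  have hlow := le_integral_rpow_trigPoly_primes hN1 hz4 hs (l := l) (by linarith)
  have hcmp := sum_rpow_le_sum_totient_rpow hN1 hz1 hz8 hη0
  rw [← hlη] at hup hcmp
  rw [← hVu] at hup
  rw [← hV, ← hR] at hlow
  set H := ∑ k ∈ Finset.Icc 1 ⌊N⌋₊, (k : ℝ) ^ (-(1 + η)) with hH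
  set W := ∑ q ∈ sieveModuli 0 z, (q.totient : ℝ) ^ (1 - l) with hW
  have hH0 : 0 ≤ H := Finset.sum_nonneg fun _ _ => by positivity
  have hW0 : 0 ≤ W := Finset.sum_nonneg fun _ _ => by positivity
  clear_value H W V Vu
  -- The unbounded factor 2^(1+η) is harmless: it merges with A^(1+η), and the l-th root turns it
  -- into √2.
  have hlog4 : Real.log 4 ^ (1 + η) + H ≤ 2 ^ (1 + η) * (14 * W) := by
    have h1 : Real.log 4 ≤ 2 := by
      have h4 : Real.log 4 = 2 * Real.log 2 := by
        rw [show (4 : ℝ) = 2 ^ 2 by norm_num, Real.log_pow]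
        norm_num
      linarith [Real.log_two_lt_d9]
    have h2 : Real.log 4 ^ (1 + η) ≤ 2 ^ (1 + η) :=
      Real.rpow_le_rpow (Real.log_nonneg (by norm_num)) h1 (by linarith)
    have h3 : (1 : ℝ) ≤ 2 ^ (1 + η) := Real.one_le_rpow (by norm_num) (by linarith)
    nlinarith
  have hRl : (R / 2) ^ l = (R ^ 2 / 4) ^ (1 + η) := by
    rw [hlη, Real.rpow_mul (by positivity), Real.rpow_two]
    congr 1
    ring
  set D : ℝ := 16 * c * ((N / Real.log N) / (1 + R)) with hD
  have hD0 : 0 ≤ D := by positivity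
  clear_value D
  have hAD : 2 * A ≤ D * (R ^ 2 / 4) := by
    have e : D * (R ^ 2 / 4) = 2 * A * (2 * R / (1 + R)) := by
      rw [hD, hA]
      field_simp
      ring
    rw [e]
    refine le_mul_of_one_le_right (by positivity) ?_
    rw [le_div_iff₀ (by positivity)]
    linarith
  have hratio : Vu ≤ 336 * D ^ (1 + η) * V := by
    calc Vu ≤ 2 / N * (A ^ (1 + η) * (2 ^ (1 + η) * (14 * W))) :=
          hup.trans (mul_le_mul_of_nonneg_left
            (mul_le_mul_of_nonneg_left hlog4 (by positivity)) (by positivity))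
      _ = 28 / N * W * (2 * A) ^ (1 + η) := by
          rw [Real.mul_rpow (by norm_num) hA0]
          ring
      _ ≤ 28 / N * W * (D * (R ^ 2 / 4)) ^ (1 + η) := by
          exact mul_le_mul_of_nonneg_left
            (Real.rpow_le_rpow (by positivity) hAD (by linarith)) (by positivity)
      _ = 336 * D ^ (1 + η) * (1 / (12 * N) * (R / 2) ^ l * W) := by
          rw [Real.mul_rpow hD0 (by positivity), hRl]
          field_simp
          ring
      _ ≤ 336 * D ^ (1 + η) * V := mul_le_mul_of_nonneg_left hlow (by positivity)
  calc Vu ^ (1 / l) ≤ (336 * D ^ (1 + η) * V) ^ (1 / l) :=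
        Real.rpow_le_rpow hVu0 hratio (by positivity)
    _ = (336 : ℝ) ^ (1 / l) * (D ^ (1 + η)) ^ (1 / l) * V ^ (1 / l) := by
        rw [Real.mul_rpow (by positivity) hV0, Real.mul_rpow (by norm_num) (by positivity)]
    -- Uniformity in l: (1+η)/l is exactly 1/2, and 336 = 28 · 12 is the only constant not raised to
    -- the power 1+η, so its l-th root is at most 336.
    _ ≤ 336 * Real.sqrt D * V ^ (1 / l) := by
        refine mul_le_mul_of_nonneg_right (mul_le_mul ?_ ?_ (by positivity) (by norm_num))
          (by positivity)
        · have h1 : 1 / l ≤ 1 := by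
            rw [div_le_one hl0]
            linarith
          calc (336 : ℝ) ^ (1 / l) ≤ (336 : ℝ) ^ (1 : ℝ) :=
                Real.rpow_le_rpow_of_exponent_le (by norm_num) h1
            _ = 336 := Real.rpow_one _
        · rw [← Real.rpow_mul hD0, Real.sqrt_eq_rpow]
          apply le_of_eq
          congr 1
          rw [hlη]
          field_simp
    _ = _ := by
        rw [hD, Real.sqrt_mul (by positivity)]
        ring
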